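/- **Theorem.** Let $p_\theta(x)=h(x)e^{\theta x-A(\theta)}$, $\theta\in\Theta$, be a one-dimensional natural exponential family of probability densities with respect to a measure $\lambda$ on $\mathbb R$, where $h>0$ on the sample space $\mathcal X\subseteq\mathbb R$, $A(\theta)=\ln\int e^{\theta x}h(x)\,d\lambda(x)$, and $\Theta\subseteq\{\theta: A(\theta)<\infty\}$ has nonempty interior. Let $M$ be the set of means of the $p_\theta$, $\theta\in\Theta$, and for $\mu\in M$ let $V(\mu)$ be the variance of the member with mean $\mu$ and $\sigma(\mu)=V(\mu)^{1/2}$. For data write $p_\theta(x^n)=\prod_{t=1}^n p_\theta(x_t)$. Let $m$ be such that for all $x^m\in\mathcal X^m$ one has $\int_\Theta p_\theta(x^m)\,I(\theta)^{1/2}\,d\theta<\infty$, with $I$ the Fisher information, and $\int_{\mathcal X^{k}}\sup_{\theta\in\Theta}p_\theta(x^m y^k)\,d\lambda^k(y^k)<\infty$ for all $k\ge 0$ (for example, the smallest such $m$). The sequential normalized maximum likelihood (SNML) strategy given $x^m$ is $$p_{\rm snml}(x_{m+1}^n\mid x^m)=\prod_{t=m+1}^n\frac{\sup_{\theta\in\Theta}p_\theta(x^t)}{\int_{\mathcal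 X}\sup_{\theta\in\Theta}p_\theta(x^{t-1},y)\,d\lambda(y)} .$$ If SNML is exchangeable, i.e. for all $n>m$ and all $x^n\in\mathcal X^n$ the value $p_{\rm snml}(x_{m+1}^n\mid x^m)$ is invariant under every permutation of $x_1,\dots,x_n$ that fixes $x_1,\dots,x_m$, then $\sigma$ is twice continuously differentiable on the interior of $M$, and there is a constant $c$ such that $$\Big(\frac{d\sigma}{d\mu}\Big)^2+3\,\sigma\,\frac{d^2\sigma}{d\mu^2}=c\qquad\text{for all }\mu\text{ in the interior of }M .$$ -/

import Mathlib

open MeasureTheory ProbabilityTheory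
open scoped ENNReal

/-- A one-dimensional natural exponential family `p_θ(x) = h(x) e^{θ x - A(θ)}`, `θ ∈ Θ`, of
densities with respect to an underlying measure `base` on `ℝ`. The sample space is `{x | 0 < h x}`:
the function `h` is extended by `0` outside the sample space. The set `Θ` need not be the full
natural parameter space, but it has nonempty interior. -/
structure NatExpFamily where
  /-- the underlying measure (for instance Lebesgue measure, or counting measure on `ℤ ⊆ ℝ`) -/
  base : Measure ℝ
  sigmaFinite_base : SigmaFinite base
  /-- the density of the reference measure with respect to the underlying measure -/
  h : ℝ → ℝ
  measurable_h : Measurable h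
  h_nonneg : ∀ x, 0 ≤ h x
  reference_ne_zero : base.withDensity (fun x => ENNReal.ofReal (h x)) ≠ 0
  /-- the natural parameter set -/
  Θ : Set ℝ
  measurableSet_Θ : MeasurableSet Θ
  Θ_subset_full :
    Θ ⊆ integrableExpSet (fun x : ℝ => x) (base.withDensity fun x => ENNReal.ofReal (h x))
  interior_Θ_nonempty : (interior Θ).Nonempty

namespace NatExpFamily

noncomputable section

/-- The reference measure `h dλ`. -/
def reference (E : NatExpFamily) : Measure ℝ :=
  E.base.withDensity fun x => ENNReal.ofReal (E.h x)

/-- The outcomes. -/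
def sampleSpace (E : NatExpFamily) : Set ℝ := {x | 0 < E.h x}

/-- The cumulant generating function `A(θ) = ln ∫ e^{θ x} dh(x)`. -/
def A (E : NatExpFamily) (θ : ℝ) : ℝ := cgf (fun x : ℝ => x) E.reference θ

/-- The density `p_θ(x) = h(x) e^{θ x - A(θ)}` with respect to the underlying measure. -/
def pdf (E : NatExpFamily) (θ x : ℝ) : ℝ := E.h x * Real.exp (θ * x - E.A θ)

/-- The distribution with density `p_θ`. -/
def dist (E : NatExpFamily) (θ : ℝ) : Measure ℝ :=
  E.base.withDensity fun x => ENNReal.ofReal (E.pdf θ x)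

/-- The density `p_θ(x^n) = ∏ p_θ(x_t)` of `n` outcomes. -/
def jointPdf (E : NatExpFamily) (θ : ℝ) {n : ℕ} (x : Fin n → ℝ) : ℝ≥0∞ :=
  ∏ i, ENNReal.ofReal (E.pdf θ (x i))

/-! ### Mean-value parameterization -/

/-- The mean of `p_θ`; meaningful when `p_θ` has a finite mean. -/
def mean (E : NatExpFamily) (θ : ℝ) : ℝ := ∫ x, x ∂E.dist θ

/-- The parameters in `Θ` whose distribution has a finite mean (this can fail only at an end point
of the full natural parameter space). -/
def finiteMeanParams (E : NatExpFamily) : Set ℝ :=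
  {θ ∈ E.Θ | Integrable (fun x : ℝ => x) (E.dist θ)}

/-- The mean-value parameter space `M`. -/
def meanSpace (E : NatExpFamily) : Set ℝ := E.mean '' E.finiteMeanParams

/-- The variance function: `V(μ)` is the variance of the member of the family with mean `μ`. -/
def V (E : NatExpFamily) (μ : ℝ) : ℝ :=
  variance (fun x : ℝ => x) (E.dist (Function.invFunOn E.mean E.finiteMeanParams μ))

/-- The standard deviation as a function of the mean, `σ(μ) = V(μ)^{1/2}`. -/
def σ (E : NatExpFamily) (μ : ℝ) : ℝ := Real.sqrt (E.V μ)

/-! ### Prediction strategies -/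

/-- The maximized likelihood `sup_{θ ∈ Θ} p_θ(x^n)`. -/
def maxLik (E : NatExpFamily) {n : ℕ} (x : Fin n → ℝ) : ℝ≥0∞ :=
  ⨆ θ ∈ E.Θ, E.jointPdf θ x

/-- The conditional Shtarkov integral `∫ sup_θ p_θ(x^m y^k) dλ^k(y^k)`. The integrand vanishes
when some coordinate of `y` lies outside the sample space. -/
def shtarkov (E : NatExpFamily) {m : ℕ} (x : Fin m → ℝ) (k : ℕ) : ℝ≥0∞ :=
  ∫⁻ y : Fin k → ℝ, E.maxLik (Fin.append x y) ∂Measure.pi (fun _ => E.base)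

/-- Conditional normalized maximum likelihood with horizon `m + k`:
the density of `y = x_{m+1}^{m+k}` given `x = x^m`. -/
def cnml (E : NatExpFamily) {m k : ℕ} (x : Fin m → ℝ) (y : Fin k → ℝ) : ℝ≥0∞ :=
  E.maxLik (Fin.append x y) / E.shtarkov x k

/-- The SNML prediction of the next outcome: CNML with the next round as the horizon. -/
def snmlNext (E : NatExpFamily) {t : ℕ} (x : Fin t → ℝ) (z : ℝ) : ℝ≥0∞ :=
  E.cnml x (fun _ : Fin 1 => z)

/-- The joint SNML density of `y = x_{m+1}^{m+k}` given `x = x^m`, the product of the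
predictions of `x_{m+1+t}` given `x_1, …, x_{m+t}` for `t < k`. -/
def snml (E : NatExpFamily) {m k : ℕ} (x : Fin m → ℝ) (y : Fin k → ℝ) : ℝ≥0∞ :=
  ∏ t : Fin k, E.snmlNext (Fin.append x fun i : Fin t => y (Fin.castLE t.isLt.le i)) (y t)

/-- The Fisher information in the natural parameterization: the second moment under `p_θ` of the
derivative of `ln p_θ(x)` in `θ`. -/
def fisherInfo (E : NatExpFamily) (θ : ℝ) : ℝ≥0∞ :=
  ∫⁻ x, ENNReal.ofReal (deriv (fun s => Real.log (E.pdf s x)) θ ^ 2) ∂E.dist θ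

/-- `∫_Θ p_θ(x^n) I(θ)^{1/2} dθ`, the normalizer of the posterior of Jeffreys prior. -/
def jeffreysMarginal (E : NatExpFamily) {n : ℕ} (x : Fin n → ℝ) : ℝ≥0∞ :=
  ∫⁻ θ in E.Θ, E.jointPdf θ x * E.fisherInfo θ ^ (1 / 2 : ℝ)

/-- Conditioning on any `m` initial outcomes makes Jeffreys' posterior proper and the conditional
Shtarkov integrals of all horizons finite. -/
def IsInitialLength (E : NatExpFamily) (m : ℕ) : Prop :=
  ∀ x : Fin m → ℝ, (∀ i, x i ∈ E.sampleSpace) →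
    E.jeffreysMarginal x < ∞ ∧ ∀ k, E.shtarkov x k < ∞

/-- SNML conditioned on `m` initial outcomes is exchangeable: for all data, the joint density of
the later outcomes is invariant under permutations that fix the initial outcomes. -/
def SNMLExchangeable (E : NatExpFamily) (m : ℕ) : Prop :=
  ∀ (k : ℕ) (x : Fin m → ℝ) (y : Fin k → ℝ),
    (∀ i, x i ∈ E.sampleSpace) → (∀ j, y j ∈ E.sampleSpace) →
      ∀ π : Equiv.Perm (Fin k), E.snml x (y ∘ π) = E.snml x y

end

end NatExpFamily

/-! The likelihood depends on the data only through their number and their sum, up to factors `h`.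
Let R_n(s) be the maximized likelihood of n outcomes with sum s, divided by its integral over one
further outcome (factors `h` removed). Interchanging two final outcomes a, b cancels everything in
the SNML product except R_n(s + a) = R_n(s + b), where s is the sum of the n - 1 earlier outcomes
(`div_normalizer_eq_of_swap`). By iteration R_n takes one value at all sums na + j(b - a) with j ≤ n
- m (`div_normalizer_eq`). Hence two means that divide [a, b] in rational proportions give the same
R_n(nμ) for infinitely many n.

On the other hand, tilting to the member θ with mean μ gives 1/R_n(nμ) = E_θ sup_t exp(t(X - μ) - (n
+ 1)K(t)), with K the centred cumulant generating function (`lintegral_penalizedSup_eq`). Put N = n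
+ 1, w = X - μ, and let V, κ₃, κ₄ be the cumulants. The largest exponent is w²/(2VN) - κ₃w³/(6V³N²)
+ O(w⁴/N³) while |w|/N is small; for larger |w| the supremum is exponentially negligible, since
raising the penalty from a level with finite integral gains a factor e^{-cN}. Taking expectations
gives 1 + 1/(2N) + Q(θ)/N² + o(N⁻²) with Q = κ₄/(8V²) + 3/8 - κ₃²/(6V³)
(`tendsto_lintegral_penalizedSup`, `tendsto_ratio`).

So Q agrees at the rational pairs, and by density and continuity it is constant
(`secondOrderCoeff_eq`). Finally dθ/dμ = 1/V turns cumulants into derivatives of σ, and σ'² + 3σσ''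
= 12Q - 9/2 (`deriv_σ_sq_add`). -/

/-- The supremum over `t ∈ T` of `exp (t w - N K(t))`. -/
noncomputable def penalizedSup (T : Set ℝ) (K : ℝ → ℝ) (N w : ℝ) : ℝ≥0∞ :=
  ⨆ t ∈ T, ENNReal.ofReal (Real.exp (t * w - N * K t))

/-! ### Decay of the penalized supremum far from the centre -/

section PenalizedSup

variable {T : Set ℝ} {K : ℝ → ℝ}

lemma measurable_penalizedSup (T : Set ℝ) (K : ℝ → ℝ) (N : ℝ) :
    Measurable (penalizedSup T K N) := by
  refine LowerSemicontinuous.measurable ?_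
  refine lowerSemicontinuous_biSup fun t _ => Continuous.lowerSemicontinuous ?_
  exact ENNReal.continuous_ofReal.comp (by fun_prop)

lemma penalizedSup_le_iff {N w u : ℝ} :
    penalizedSup T K N w ≤ ENNReal.ofReal (Real.exp u) ↔ ∀ t ∈ T, t * w - N * K t ≤ u := by
  simp [penalizedSup, ENNReal.ofReal_le_ofReal_iff (Real.exp_pos _).le]

lemma le_penalizedSup {N w t : ℝ} (ht : t ∈ T) :
    ENNReal.ofReal (Real.exp (t * w - N * K t)) ≤ penalizedSup T K N w :=
  le_iSup₂_of_le t ht le_rfl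

lemma penalizedSup_antitone (hK : ∀ t ∈ T, 0 ≤ K t) {M N : ℝ} (h : M ≤ N) (w : ℝ) :
    penalizedSup T K N w ≤ penalizedSup T K M w := by
  refine iSup₂_mono fun t ht => ENNReal.ofReal_le_ofReal (Real.exp_le_exp.2 ?_)
  nlinarith [hK t ht]

/-- Away from the centre, the penalized supremum decays exponentially in the penalty. -/
lemma penalizedSup_le_exp_mul (hK : ∀ t ∈ T, 0 ≤ K t) (hT : T ∈ nhds 0)
    {C ρ₀ : ℝ} (hρ₀ : 0 < ρ₀) (hquad : ∀ t, |t| ≤ ρ₀ → K t ≤ C * t ^ 2)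
    (hlin : ∀ ρ > 0, ∃ k > 0, ∀ t ∈ T, ρ ≤ |t| → k * |t| ≤ K t) {ε : ℝ} (hε : 0 < ε) :
    ∃ c > 0, ∀ N₀ N w : ℝ, 0 ≤ N₀ → N₀ ≤ N → ε * N ≤ |w| →
      penalizedSup T K N w ≤
        ENNReal.ofReal (Real.exp (-(c * (N - N₀)))) * penalizedSup T K N₀ w := by
  obtain ⟨r, hr, hrT⟩ := Metric.mem_nhds_iff.1 hT
  set C' := max C 1 with hC'
  have hC'pos : 0 < C' := lt_of_lt_of_le one_pos (le_max_right _ _)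
  -- The last condition makes the penalty N K(±2ρ) at most ρ|w| as soon as εN ≤ |w|.
  obtain ⟨ρ, hρ, h1, h2, h3⟩ : ∃ ρ > 0, 2 * ρ < r ∧ 2 * ρ ≤ ρ₀ ∧ 4 * C' * ρ ≤ ε := by
    refine ⟨min (r / 4) (min (ρ₀ / 2) (ε / (4 * C'))), by positivity, ?_, ?_, ?_⟩
    · linarith [min_le_left (r / 4) (min (ρ₀ / 2) (ε / (4 * C')))]
    · linarith [(min_le_right (r / 4) (min (ρ₀ / 2) (ε / (4 * C')))).trans (min_le_left _ _)]
    · have := (min_le_right (r / 4) (min (ρ₀ / 2) (ε / (4 * C')))).trans (min_le_right _ _)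
      calc 4 * C' * _ ≤ 4 * C' * (ε / (4 * C')) := by gcongr
        _ = ε := by field_simp
  obtain ⟨k, hk, hkT⟩ := hlin ρ hρ
  refine ⟨k * ρ, by positivity, fun N₀ N w hN₀ hN hw => ?_⟩
  -- Here K(t) ≥ kρ, so the additional penalty N - N₀ costs at least the stated factor.
  have far : ∀ t ∈ T, ρ ≤ |t| → ENNReal.ofReal (Real.exp (t * w - N * K t)) ≤
      ENNReal.ofReal (Real.exp (-(k * ρ * (N - N₀)))) * penalizedSup T K N₀ w := by
    intro t ht hρt
    refine le_trans ?_ (mul_le_mul_right (le_penalizedSup ht) _)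
    rw [← ENNReal.ofReal_mul (Real.exp_pos _).le, ← Real.exp_add]
    refine ENNReal.ofReal_le_ofReal (Real.exp_le_exp.2 ?_)
    have : k * ρ ≤ K t := le_trans (by gcongr) (hkT t ht hρt)
    nlinarith
  refine iSup₂_le fun t ht => ?_
  rcases le_or_gt ρ |t| with hρt | hρt
  · exact far t ht hρt
  -- A point with |t| < ρ is beaten by ±2ρ with the sign of w: it reaches at most ρ|w|, while the
  -- other gains 2ρ|w| and pays at most ρ|w|. This reduces to the far case.
  · obtain ⟨t', ht', htw⟩ : ∃ t', |t'| = 2 * ρ ∧ t' * w = 2 * ρ * |w| := by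
      rcases le_total 0 w with h | h
      · exact ⟨2 * ρ, abs_of_pos (by positivity), by rw [abs_of_nonneg h]⟩
      · exact ⟨-(2 * ρ), by rw [abs_neg, abs_of_pos (by positivity)], by
          rw [abs_of_nonpos h]; ring⟩
    have ht'T : t' ∈ T := hrT (by simp [ht', h1])
    refine le_trans (ENNReal.ofReal_le_ofReal (Real.exp_le_exp.2 ?_)) (far t' ht'T (by linarith))
    have e1 : K t' ≤ C' * (2 * ρ) ^ 2 := by
      refine (hquad t' (by linarith)).trans ?_
      rw [← sq_abs t', ht']; gcongr; exact le_max_left _ _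
    have e2 : t * w ≤ ρ * |w| := by
      calc t * w ≤ |t * w| := le_abs_self _
        _ = |t| * |w| := abs_mul _ _
        _ ≤ ρ * |w| := by gcongr
    have e3 : 0 ≤ N * K t := mul_nonneg (hN₀.trans hN) (hK t ht)
    have e4 : N * K t' ≤ ρ * |w| := by
      calc N * K t' ≤ N * (C' * (2 * ρ) ^ 2) := by
            gcongr; exact hN₀.trans hN
        _ = N * (4 * C' * ρ) * ρ := by ring
        _ ≤ N * ε * ρ := by gcongr; exact hN₀.trans hN
        _ ≤ ρ * |w| := by nlinarith
    linarith

end PenalizedSup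

/-! ### Local expansion of the Legendre transform and of its exponential -/

/-- Near 0 the cubic and quartic terms each cost at most Vt²/8 of the leading Vt²/2. -/
lemma exists_quadratic_lower_bound {K : ℝ → ℝ} {V κ C ρ₀ : ℝ} (hV : 0 < V) (hC : 0 ≤ C)
    (hρ₀ : 0 < ρ₀)
    (htaylor : ∀ t, |t| ≤ ρ₀ → |K t - (V * t ^ 2 / 2 + κ * t ^ 3 / 6)| ≤ C * t ^ 4) :
    ∃ ρ > 0, ρ ≤ ρ₀ ∧ ∀ t, |t| ≤ ρ → V * t ^ 2 / 4 ≤ K t := by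
  obtain ⟨ρ, hρ, h1, h2, h3⟩ : ∃ ρ > 0, ρ ≤ ρ₀ ∧ |κ| * ρ / 6 ≤ V / 8 ∧ C * ρ ^ 2 ≤ V / 8 := by
    have : ∀ᶠ ρ in nhdsWithin (0 : ℝ) (Set.Ioi 0),
        ρ ≤ ρ₀ ∧ |κ| * ρ / 6 ≤ V / 8 ∧ C * ρ ^ 2 ≤ V / 8 := by
      refine Filter.Eventually.filter_mono nhdsWithin_le_nhds ?_
      have l1 : ∀ᶠ ρ in nhds (0 : ℝ), ρ < ρ₀ := eventually_lt_nhds hρ₀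
      have l2 : ∀ᶠ ρ in nhds (0 : ℝ), |κ| * ρ / 6 < V / 8 := by
        have : ContinuousAt (fun ρ : ℝ => |κ| * ρ / 6) 0 := by fun_prop
        exact this.eventually_lt_const (by simpa using hV)
      have l3 : ∀ᶠ ρ in nhds (0 : ℝ), C * ρ ^ 2 < V / 8 := by
        have : ContinuousAt (fun ρ : ℝ => C * ρ ^ 2) 0 := by fun_prop
        exact this.eventually_lt_const (by simpa using hV)
      filter_upwards [l1, l2, l3] with ρ a b c using ⟨a.le, b.le, c.le⟩
    obtain ⟨ρ, h, hρ⟩ := (this.and self_mem_nhdsWithin).exists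
    exact ⟨ρ, hρ, h⟩
  refine ⟨ρ, hρ, h1, fun t ht => ?_⟩
  have a1 := (abs_le.1 (htaylor t (ht.trans h1))).1
  have a2 : |κ * t ^ 3 / 6| ≤ V / 8 * t ^ 2 := by
    have : |κ * t ^ 3 / 6| = |κ| * |t| / 6 * t ^ 2 := by
      rw [abs_div, abs_mul, abs_pow, pow_succ, sq_abs]; norm_num; ring
    rw [this]
    refine mul_le_mul_of_nonneg_right (le_trans ?_ h2) (sq_nonneg t)
    gcongr
  have a3 : C * t ^ 4 ≤ V / 8 * t ^ 2 := by
    have : t ^ 2 ≤ ρ ^ 2 := sq_le_sq' (abs_le.1 ht).1 (abs_le.1 ht).2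
    calc C * t ^ 4 = C * t ^ 2 * t ^ 2 := by ring
      _ ≤ C * ρ ^ 2 * t ^ 2 := by gcongr
      _ ≤ _ := by gcongr
  linarith [(abs_le.1 a2).1]

/-- The test point t = δ/V, the maximizer for the quadratic part, gives the lower bound. For the
upper bound, linear growth for |t| ≥ ρ and quadratic growth for 4|δ|/V ≤ |t| < ρ make tδ - K(t)
nonpositive. For the remaining t, the loss (V/2)(t - δ/V)² of the quadratic part absorbs the change
in the cubic term between t and δ/V. -/
lemma cubic_legendre_bounds {T : Set ℝ} {K : ℝ → ℝ} (hT : T ∈ nhds 0)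
    {V κ C ρ₀ : ℝ} (hV : 0 < V) (hC : 0 ≤ C) (hρ₀ : 0 < ρ₀)
    (htaylor : ∀ t, |t| ≤ ρ₀ → |K t - (V * t ^ 2 / 2 + κ * t ^ 3 / 6)| ≤ C * t ^ 4)
    (hlin : ∀ ρ > 0, ∃ k > 0, ∀ t ∈ T, ρ ≤ |t| → k * |t| ≤ K t) :
    ∃ D ≥ 0, ∃ ε > 0, ∀ δ, |δ| ≤ ε →
      (∀ t ∈ T, t * δ - K t ≤ δ ^ 2 / (2 * V) - κ * δ ^ 3 / (6 * V ^ 3) + D * δ ^ 4) ∧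
      ∃ t ∈ T, δ ^ 2 / (2 * V) - κ * δ ^ 3 / (6 * V ^ 3) - D * δ ^ 4 ≤ t * δ - K t := by
  obtain ⟨r, hr, hrT⟩ := Metric.mem_nhds_iff.1 hT
  obtain ⟨ρ, hρ, h1, hKquad⟩ := exists_quadratic_lower_bound hV hC hρ₀ htaylor
  obtain ⟨k, hk, hkT⟩ := hlin ρ hρ
  -- The number 21 = 16 + 4 + 1 bounds t² + t(δ/V) + (δ/V)² in units of (δ/V)² when |t| ≤ 4|δ|/V. In
  -- `D`, the first summand is the Taylor error at such t, the second what is left after completing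
  -- the square in |t - δ/V|.
  set B := |κ| / 6 * (21 / V ^ 2) with hB
  set D := C * (4 / V) ^ 4 + B ^ 2 / (2 * V) with hD
  have hD0 : 0 ≤ D := by positivity
  -- In order: linear growth dominates |δ||t|; δ/V lies in `T`; the Taylor bound holds at δ/V; the
  -- claimed upper bound is nonnegative, which settles every t with tδ ≤ K(t).
  obtain ⟨ε, hε, g1, g2, g3, g4⟩ : ∃ ε > 0, ε ≤ k ∧ ε / V < r ∧ ε / V ≤ ρ ∧
      |κ| * ε / (6 * V ^ 3) ≤ 1 / (2 * V) := by
    have : ∀ᶠ ε in nhdsWithin (0 : ℝ) (Set.Ioi 0), ε ≤ k ∧ ε / V < r ∧ ε / V ≤ ρ ∧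
      |κ| * ε / (6 * V ^ 3) ≤ 1 / (2 * V) := by
      refine Filter.Eventually.filter_mono nhdsWithin_le_nhds ?_
      have l1 : ∀ᶠ ε in nhds (0 : ℝ), ε < k := eventually_lt_nhds hk
      have c2 : ContinuousAt (fun ρ : ℝ => ρ / V) 0 := by fun_prop
      have c3 : ContinuousAt (fun ρ : ℝ => |κ| * ρ / (6 * V ^ 3)) 0 := by fun_prop
      have l2 : ∀ᶠ ε in nhds (0 : ℝ), ε / V < r := c2.eventually_lt_const (by simpa using hr)
      have l3 : ∀ᶠ ε in nhds (0 : ℝ), ε / V < ρ := c2.eventually_lt_const (by simpa using hρ)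
      have l4 : ∀ᶠ ε in nhds (0 : ℝ), |κ| * ε / (6 * V ^ 3) < 1 / (2 * V) :=
        c3.eventually_lt_const (by simpa using hV)
      filter_upwards [l1, l2, l3, l4] with ρ a b c d using ⟨a.le, b, c.le, d.le⟩
    obtain ⟨ρ, h, hρ⟩ := (this.and self_mem_nhdsWithin).exists
    exact ⟨ρ, hρ, h⟩
  refine ⟨D, hD0, ε, hε, fun δ hδ => ⟨fun t ht => ?_, ?_⟩⟩
  · have hnonneg : 0 ≤ δ ^ 2 / (2 * V) - κ * δ ^ 3 / (6 * V ^ 3) + D * δ ^ 4 := by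
      have : |κ * δ ^ 3 / (6 * V ^ 3)| ≤ 1 / (2 * V) * δ ^ 2 := by
        have e : |κ * δ ^ 3 / (6 * V ^ 3)| = |κ| * |δ| / (6 * V ^ 3) * δ ^ 2 := by
          rw [abs_div, abs_mul, abs_pow, pow_succ, sq_abs, abs_of_pos (by positivity : 0 < 6 * V ^ 3)]
          ring
        rw [e]
        refine mul_le_mul_of_nonneg_right (le_trans ?_ g4) (sq_nonneg δ)
        gcongr
      have e2 : δ ^ 2 / (2 * V) = 1 / (2 * V) * δ ^ 2 := by ring
      have e3 : 0 ≤ D * δ ^ 4 := by positivity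
      linarith [(abs_le.1 this).2]
    have habs : t * δ ≤ |t| * |δ| := by rw [← abs_mul]; exact le_abs_self _
    rcases le_or_gt ρ |t| with hρt | hρt
    · have := hkT t ht hρt
      have : |t| * |δ| ≤ k * |t| := by rw [mul_comm]; gcongr; exact hδ.trans g1
      linarith
    rcases le_or_gt (4 / V * |δ|) |t| with h4 | h4
    · have := hKquad t hρt.le
      have : |t| * |δ| ≤ V * t ^ 2 / 4 := by
        rw [← sq_abs t]
        have : |δ| ≤ V / 4 * |t| := by
          calc |δ| = V / 4 * (4 / V * |δ|) := by field_simp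
            _ ≤ _ := by gcongr
        nlinarith [abs_nonneg t]
      linarith
    · have a1 := (abs_le.1 (htaylor t (hρt.le.trans h1))).1
      have a2 : C * t ^ 4 ≤ C * (4 / V) ^ 4 * δ ^ 4 := by
        have : t ^ 4 ≤ (4 / V * |δ|) ^ 4 := by
          rw [← (show Even 4 by decide).pow_abs t]; gcongr
        rw [mul_pow, (show Even 4 by decide).pow_abs δ] at this
        rw [mul_assoc]; gcongr
      set s := t - δ / V with hs
      have e1 : t * δ - V * t ^ 2 / 2 = δ ^ 2 / (2 * V) - V / 2 * s ^ 2 := by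
        rw [hs]; field_simp; ring
      have e2 : κ * t ^ 3 / 6 - κ * δ ^ 3 / (6 * V ^ 3) =
          κ / 6 * (s * (t ^ 2 + t * (δ / V) + (δ / V) ^ 2)) := by
        rw [hs]; field_simp; ring
      have e3 : |κ / 6 * (s * (t ^ 2 + t * (δ / V) + (δ / V) ^ 2))| ≤ B * δ ^ 2 * |s| := by
        have i1 : |t ^ 2 + t * (δ / V) + (δ / V) ^ 2| ≤ 21 / V ^ 2 * δ ^ 2 := by
          have j1 : |t| ^ 2 ≤ (4 / V * |δ|) ^ 2 := by gcongr
          have j2 : |t| * (|δ| / V) ≤ (4 / V * |δ|) * (|δ| / V) := by gcongr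
          calc |t ^ 2 + t * (δ / V) + (δ / V) ^ 2|
              ≤ |t ^ 2| + |t * (δ / V)| + |(δ / V) ^ 2| := abs_add_three _ _ _
            _ = |t| ^ 2 + |t| * (|δ| / V) + (|δ| / V) ^ 2 := by
                rw [abs_pow, abs_mul, abs_pow, abs_div, abs_of_pos hV]
            _ ≤ (4 / V * |δ|) ^ 2 + (4 / V * |δ|) * (|δ| / V) + (|δ| / V) ^ 2 := by gcongr
            _ = 21 / V ^ 2 * |δ| ^ 2 := by field_simp; ring
            _ = _ := by rw [sq_abs]
        rw [abs_mul, abs_mul, abs_div, hB, show |(6 : ℝ)| = 6 by norm_num]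
        calc |κ| / 6 * (|s| * |t ^ 2 + t * (δ / V) + (δ / V) ^ 2|)
            ≤ |κ| / 6 * (|s| * (21 / V ^ 2 * δ ^ 2)) := by gcongr
          _ = _ := by ring
      have e4 : B * δ ^ 2 * |s| ≤ V / 2 * s ^ 2 + B ^ 2 / (2 * V) * δ ^ 4 := by
        rw [← sq_abs s]
        have : 0 ≤ (V * |s| - B * δ ^ 2) ^ 2 / (2 * V) := by positivity
        have e : (V * |s| - B * δ ^ 2) ^ 2 / (2 * V) =
          V / 2 * |s| ^ 2 + B ^ 2 / (2 * V) * δ ^ 4 - B * δ ^ 2 * |s| := by field_simp; ring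
        linarith
      have e5 : D * δ ^ 4 = C * (4 / V) ^ 4 * δ ^ 4 + B ^ 2 / (2 * V) * δ ^ 4 := by
        rw [hD]; ring
      linarith [(abs_le.1 e3).1]
  · have hδV : |δ / V| ≤ ε / V := by rw [abs_div, abs_of_pos hV]; gcongr
    refine ⟨δ / V, hrT (mem_ball_zero_iff.2 (hδV.trans_lt g2)), ?_⟩
    have a1 := (abs_le.1 (htaylor (δ / V) ((hδV.trans g3).trans h1))).2
    have e1 : δ / V * δ - V * (δ / V) ^ 2 / 2 = δ ^ 2 / (2 * V) := by field_simp; ring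
    have e2 : κ * (δ / V) ^ 3 / 6 = κ * δ ^ 3 / (6 * V ^ 3) := by field_simp
    have e3 : C * (δ / V) ^ 4 ≤ D * δ ^ 4 := by
      have : C * (4 / V) ^ 4 * δ ^ 4 = 256 * (C * (δ / V) ^ 4) := by field_simp; ring
      have p1 : 0 ≤ C * (δ / V) ^ 4 := by positivity
      have p2 : 0 ≤ B ^ 2 / (2 * V) * δ ^ 4 := by positivity
      have e5 : D * δ ^ 4 = C * (4 / V) ^ 4 * δ ^ 4 + B ^ 2 / (2 * V) * δ ^ 4 := by
        rw [hD]; ring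
      linarith
    linarith

/-- Absorbs the polynomial errors below into a single exponential moment. -/
lemma abs_pow_le_mul_exp {a : ℝ} (ha : 0 < a) (k : ℕ) :
    ∃ C ≥ 0, ∀ y : ℝ, 0 ≤ y → y ^ k ≤ C * Real.exp (a * y) := by
  refine ⟨k.factorial / a ^ k, by positivity, fun y hy => ?_⟩
  have := Real.pow_div_factorial_le_exp (a * y) (by positivity) k
  rw [div_le_iff₀ (by positivity), mul_pow] at this
  rw [div_mul_eq_mul_div, le_div_iff₀ (by positivity)]
  linarith

/-- The second order expansion of `exp (w² / (2 N V) - κ w³ / (6 V³ N²))` in `1 / N`. -/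
noncomputable def expansion (V κ N w : ℝ) : ℝ :=
  1 + w ^ 2 / (2 * V) / N + (w ^ 4 / (8 * V ^ 2) - κ * w ^ 3 / (6 * V ^ 3)) / N ^ 2

/-- Three errors of order N⁻³ are added: truncating the exponential series after u²/2, the assumed
error in u, and replacing u² by the square of its leading term w²/(2VN). -/
lemma abs_exp_sub_expansion_le {V : ℝ} (κ : ℝ) {D ε a : ℝ} (hV : 0 < V) (hD : 0 ≤ D) (hε : 0 < ε)
    (ha : 0 < a) :
    ∃ ε' > 0, ε' ≤ ε ∧ ∃ C ≥ 0, ∀ N w u : ℝ, 1 ≤ N → |w| ≤ ε' * N →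
      |u - (w ^ 2 / (2 * V) / N - κ * w ^ 3 / (6 * V ^ 3) / N ^ 2)| ≤ D * w ^ 4 / N ^ 3 →
      |Real.exp u - expansion V κ N w| ≤ C * Real.exp (a * |w|) / N ^ 3 := by
  set α := 1 / (2 * V) with hα
  set β := |κ| / (6 * V ^ 3) with hβ
  set E := β + D with hE
  set F := α + E with hF
  have hα0 : 0 < α := by positivity
  have hβ0 : 0 ≤ β := by positivity
  have hE0 : 0 ≤ E := by positivity
  have hF0 : 0 < F := by positivity
  obtain ⟨C4, hC4, b4⟩ := abs_pow_le_mul_exp ha 4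
  obtain ⟨C5, hC5, b5⟩ := abs_pow_le_mul_exp ha 5
  obtain ⟨C6, hC6, b6⟩ := abs_pow_le_mul_exp (half_pos ha) 6
  -- The bound a/(2F) forces |u| ≤ a|w|/2, so that e^{|u|} uses half of the exponential weight and
  -- |w|⁶ the other half; the bound 1 gives |w| ≤ N. The three summands of the constant match the
  -- three errors.
  refine ⟨min ε (min 1 (a / 2 / F)), by positivity, min_le_left _ _,
    F ^ 3 * C6 + D * C4 + E * (F + α) / 2 * C5, by positivity, fun N w u hN hw hu => ?_⟩
  have hN0 : 0 < N := by linarith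
  set y := |w| with hy
  have hy0 : 0 ≤ y := abs_nonneg w
  have hwN : y ≤ N := hw.trans (by
    have : min ε (min 1 (a / 2 / F)) ≤ 1 := (min_le_right _ _).trans (min_le_left _ _)
    nlinarith)
  have hwF : F * y ≤ a / 2 * N := by
    have : min ε (min 1 (a / 2 / F)) ≤ a / 2 / F := (min_le_right _ _).trans (min_le_right _ _)
    calc F * y ≤ F * (a / 2 / F * N) := by gcongr; exact hw.trans (by gcongr)
      _ = _ := by field_simp
  have hw2 : w ^ 2 = y ^ 2 := (sq_abs w).symm
  have hw4 : w ^ 4 = y ^ 4 := ((show Even 4 by decide).pow_abs w).symm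
  set q₀ := w ^ 2 / (2 * V) / N with hq₀
  have hq₀' : q₀ = α * y ^ 2 / N := by rw [hq₀, hw2, hα]; ring
  have h4 : D * w ^ 4 / N ^ 3 ≤ D * y ^ 3 / N ^ 2 := by
    rw [hw4, div_le_div_iff₀ (by positivity) (by positivity)]
    have : D * y ^ 4 * N ^ 2 = D * y ^ 3 * N ^ 2 * y := by ring
    rw [this, show D * y ^ 3 * N ^ 3 = D * y ^ 3 * N ^ 2 * N by ring]
    gcongr
  have h3 : |κ * w ^ 3 / (6 * V ^ 3) / N ^ 2| = β * y ^ 3 / N ^ 2 := by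
    rw [abs_div, abs_div, abs_mul, abs_pow, abs_of_pos (by positivity : 0 < N ^ 2),
      abs_of_pos (by positivity : 0 < 6 * V ^ 3), hβ]
    ring
  have huq₀ : |u - q₀| ≤ E * y ^ 3 / N ^ 2 := by
    have e : u - q₀ = (u - (q₀ - κ * w ^ 3 / (6 * V ^ 3) / N ^ 2)) -
      κ * w ^ 3 / (6 * V ^ 3) / N ^ 2 := by ring
    rw [e]
    refine (abs_sub _ _).trans ?_
    rw [h3, hE]
    calc _ ≤ D * y ^ 3 / N ^ 2 + β * y ^ 3 / N ^ 2 := by gcongr; exact hu.trans h4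
      _ = _ := by ring
  have hE2 : E * y ^ 3 / N ^ 2 ≤ E * y ^ 2 / N := by
    rw [div_le_div_iff₀ (by positivity) (by positivity)]
    rw [show E * y ^ 3 * N = E * y ^ 2 * N * y by ring,
      show E * y ^ 2 * N ^ 2 = E * y ^ 2 * N * N by ring]
    gcongr
  have hq₀abs : |q₀| = α * y ^ 2 / N := by rw [hq₀', abs_of_nonneg (by positivity)]
  have hu2 : |u| ≤ F * y ^ 2 / N := by
    have : |u| ≤ |u - q₀| + |q₀| := by simpa using abs_add_le (u - q₀) q₀
    rw [hq₀abs] at this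
    calc |u| ≤ E * y ^ 2 / N + α * y ^ 2 / N := by linarith
      _ = _ := by rw [hF]; ring
  have hua : |u| ≤ a / 2 * y := by
    refine hu2.trans ?_
    rw [div_le_iff₀ hN0]
    nlinarith
  have hexp : |Real.exp u - (1 + u + u ^ 2 / 2)| ≤
      F ^ 3 * C6 * Real.exp (a * y) / N ^ 3 := by
    have h := Complex.norm_exp_sub_sum_le_norm_mul_exp (u : ℂ) 3
    have e : Complex.exp (u : ℂ) - ∑ m ∈ Finset.range 3, (u : ℂ) ^ m / m.factorial =
        ((Real.exp u - (1 + u + u ^ 2 / 2) : ℝ) : ℂ) := by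
      simp [Finset.sum_range_succ]
    rw [e, Complex.norm_real, Complex.norm_real, Real.norm_eq_abs, Real.norm_eq_abs] at h
    refine h.trans ?_
    calc |u| ^ 3 * Real.exp |u| ≤ (F * y ^ 2 / N) ^ 3 * Real.exp (a / 2 * y) := by gcongr
      _ = F ^ 3 * y ^ 6 * Real.exp (a / 2 * y) / N ^ 3 := by ring
      _ ≤ F ^ 3 * (C6 * Real.exp (a / 2 * y)) * Real.exp (a / 2 * y) / N ^ 3 := by
          gcongr; exact b6 y hy0
      _ = F ^ 3 * C6 * (Real.exp (a / 2 * y) * Real.exp (a / 2 * y)) / N ^ 3 := by ring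
      _ = _ := by rw [← Real.exp_add]; ring_nf
  have hlin : |u - (q₀ - κ * w ^ 3 / (6 * V ^ 3) / N ^ 2)| ≤
      D * C4 * Real.exp (a * y) / N ^ 3 := by
    refine hu.trans ?_
    rw [hw4, mul_assoc D]
    gcongr
    exact b4 y hy0
  have hsq : |(u ^ 2 - q₀ ^ 2) / 2| ≤ E * (F + α) / 2 * C5 * Real.exp (a * y) / N ^ 3 := by
    have e : (u ^ 2 - q₀ ^ 2) / 2 = (u - q₀) * (u + q₀) / 2 := by ring
    have h1 : |u + q₀| ≤ (F + α) * y ^ 2 / N := by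
      refine (abs_add_le _ _).trans ?_
      rw [hq₀abs]
      calc _ ≤ F * y ^ 2 / N + α * y ^ 2 / N := by gcongr
        _ = _ := by ring
    rw [e, abs_div, abs_mul, show |(2 : ℝ)| = 2 by norm_num]
    calc |u - q₀| * |u + q₀| / 2 ≤ (E * y ^ 3 / N ^ 2) * ((F + α) * y ^ 2 / N) / 2 := by gcongr
      _ = E * (F + α) / 2 * y ^ 5 / N ^ 3 := by field_simp
      _ ≤ E * (F + α) / 2 * (C5 * Real.exp (a * y)) / N ^ 3 := by gcongr; exact b5 y hy0
      _ = _ := by ring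
  have key : Real.exp u - expansion V κ N w = (Real.exp u - (1 + u + u ^ 2 / 2)) +
      (u - (q₀ - κ * w ^ 3 / (6 * V ^ 3) / N ^ 2)) + (u ^ 2 - q₀ ^ 2) / 2 := by
    rw [expansion, hq₀]; ring
  rw [key]
  refine (abs_add_three _ _ _).trans ?_
  calc _ ≤ _ := add_le_add_three hexp hlin hsq
    _ = _ := by ring

/-- For |w| ≥ εN the factor (|w|/(εN))³ is at least 1, and inserting it buys the N⁻³ at the price of
three more powers of |w|. -/
lemma abs_expansion_le {V : ℝ} (κ : ℝ) {ε a : ℝ} (hV : 0 < V) (hε : 0 < ε) (ha : 0 < a) :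
    ∃ C ≥ 0, ∀ N w : ℝ, 1 ≤ N → ε * N ≤ |w| →
      |expansion V κ N w| ≤ C * Real.exp (a * |w|) / N ^ 3 := by
  set α := 1 / (2 * V) with hα
  set β := |κ| / (6 * V ^ 3) with hβ
  set γ := 1 / (8 * V ^ 2) with hγ
  obtain ⟨C3, hC3, b3⟩ := abs_pow_le_mul_exp ha 3
  obtain ⟨C5, hC5, b5⟩ := abs_pow_le_mul_exp ha 5
  obtain ⟨C6, hC6, b6⟩ := abs_pow_le_mul_exp ha 6
  obtain ⟨C7, hC7, b7⟩ := abs_pow_le_mul_exp ha 7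
  refine ⟨(C3 + α * C5 + β * C6 + γ * C7) / ε ^ 3, by positivity, fun N w hN hw => ?_⟩
  have hN0 : 0 < N := by linarith
  set y := |w| with hy
  have hy0 : 0 ≤ y := abs_nonneg w
  have hw2 : w ^ 2 = y ^ 2 := (sq_abs w).symm
  have hw4 : w ^ 4 = y ^ 4 := ((show Even 4 by decide).pow_abs w).symm
  have h1 : |expansion V κ N w| ≤ 1 + α * y ^ 2 + (γ * y ^ 4 + β * y ^ 3) := by
    rw [expansion]
    refine (abs_add_three _ _ _).trans ?_
    have a1 : |w ^ 2 / (2 * V) / N| ≤ α * y ^ 2 := by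
      rw [abs_of_nonneg (by positivity), hw2, hα, one_div_mul_eq_div]
      exact div_le_self (by positivity) hN
    have a2 : |(w ^ 4 / (8 * V ^ 2) - κ * w ^ 3 / (6 * V ^ 3)) / N ^ 2| ≤
        γ * y ^ 4 + β * y ^ 3 := by
      rw [abs_div, abs_of_pos (by positivity : 0 < N ^ 2)]
      refine (div_le_self (abs_nonneg _) (one_le_pow₀ hN)).trans ((abs_sub _ _).trans ?_)
      rw [abs_of_nonneg (by positivity : 0 ≤ w ^ 4 / (8 * V ^ 2)), abs_div, abs_mul, abs_pow,
        abs_of_pos (by positivity : 0 < 6 * V ^ 3), hw4]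
      apply le_of_eq; rw [hγ, hβ]; ring
    rw [abs_one]
    linarith
  have h2 : 1 ≤ y ^ 3 / (ε ^ 3 * N ^ 3) := by
    rw [one_le_div (by positivity), ← mul_pow]; gcongr
  calc _ ≤ (1 + α * y ^ 2 + (γ * y ^ 4 + β * y ^ 3)) * 1 := by rw [mul_one]; exact h1
    _ ≤ (1 + α * y ^ 2 + (γ * y ^ 4 + β * y ^ 3)) * (y ^ 3 / (ε ^ 3 * N ^ 3)) := by gcongr
    _ = (y ^ 3 + α * y ^ 5 + β * y ^ 6 + γ * y ^ 7) / ε ^ 3 / N ^ 3 := by field_simp; ring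
    _ ≤ (C3 * Real.exp (a * y) + α * (C5 * Real.exp (a * y)) + β * (C6 * Real.exp (a * y)) +
        γ * (C7 * Real.exp (a * y))) / ε ^ 3 / N ^ 3 := by
        gcongr <;> first | exact b3 y hy0 | exact b5 y hy0 | exact b6 y hy0 | exact b7 y hy0
    _ = _ := by ring

/-! ### Second order asymptotics of the expected penalized supremum -/

/-- Pointwise comparison of the penalized supremum with its expansion. -/
lemma abs_penalizedSup_sub_expansion_le {T : Set ℝ} {K : ℝ → ℝ} (hT : T ∈ nhds 0)
    (hK : ∀ t ∈ T, 0 ≤ K t) {V κ C ρ₀ : ℝ} (hV : 0 < V) (hC : 0 ≤ C) (hρ₀ : 0 < ρ₀)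
    (htaylor : ∀ t, |t| ≤ ρ₀ → |K t - (V * t ^ 2 / 2 + κ * t ^ 3 / 6)| ≤ C * t ^ 4)
    (hlin : ∀ ρ > 0, ∃ k > 0, ∀ t ∈ T, ρ ≤ |t| → k * |t| ≤ K t) {a : ℝ} (ha : 0 < a) :
    ∃ D ≥ 0, ∃ c > 0, ∀ N₀ N w : ℝ, 0 ≤ N₀ → N₀ ≤ N → 1 ≤ N → penalizedSup T K N₀ w ≠ ∞ →
      |(penalizedSup T K N w).toReal - expansion V κ N w| ≤
        D * Real.exp (a * |w|) / N ^ 3 +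
          Real.exp (-(c * (N - N₀))) * (penalizedSup T K N₀ w).toReal := by
  obtain ⟨D₁, hD₁, ε, hε, hleg⟩ := cubic_legendre_bounds hT hV hC hρ₀ htaylor hlin
  obtain ⟨ε', hε', hε'ε, D₂, hD₂, hmid⟩ := abs_exp_sub_expansion_le κ hV hD₁ hε ha
  obtain ⟨D₃, hD₃, hout⟩ := abs_expansion_le κ hV hε' ha
  have hquad : ∀ t, |t| ≤ ρ₀ → K t ≤ (V / 2 + |κ| * ρ₀ / 6 + C * ρ₀ ^ 2) * t ^ 2 := by
    intro t ht
    have h1 := (abs_le.1 (htaylor t ht)).2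
    have h2 : κ * t ^ 3 / 6 ≤ |κ| * ρ₀ / 6 * t ^ 2 := by
      calc κ * t ^ 3 / 6 ≤ |κ * t ^ 3| / 6 := by gcongr; exact le_abs_self _
        _ = |κ| * |t| / 6 * t ^ 2 := by rw [abs_mul, abs_pow, pow_succ, sq_abs]; ring
        _ ≤ _ := by gcongr
    have h3 : C * t ^ 4 ≤ C * ρ₀ ^ 2 * t ^ 2 := by
      have : t ^ 2 ≤ ρ₀ ^ 2 := sq_le_sq' (abs_le.1 ht).1 (abs_le.1 ht).2
      calc C * t ^ 4 = C * t ^ 2 * t ^ 2 := by ring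
        _ ≤ _ := by gcongr
    linarith
  obtain ⟨c, hc, htail⟩ := penalizedSup_le_exp_mul hK hT hρ₀ hquad hlin hε'
  refine ⟨D₂ + D₃, by positivity, c, hc, fun N₀ N w hN₀ hN hN1 hfin => ?_⟩
  have hN0 : 0 < N := by linarith
  have hsplit : (D₂ + D₃) * Real.exp (a * |w|) / N ^ 3 =
    D₂ * Real.exp (a * |w|) / N ^ 3 + D₃ * Real.exp (a * |w|) / N ^ 3 := by ring
  have p2 : 0 ≤ D₂ * Real.exp (a * |w|) / N ^ 3 := by positivity
  have p3 : 0 ≤ D₃ * Real.exp (a * |w|) / N ^ 3 := by positivity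
  have p4 : 0 ≤ Real.exp (-(c * (N - N₀))) * (penalizedSup T K N₀ w).toReal := by positivity
  rcases le_total |w| (ε' * N) with hw | hw
  · have hδ : |w / N| ≤ ε := by
      rw [abs_div, abs_of_pos hN0, div_le_iff₀ hN0]
      exact hw.trans (by gcongr)
    obtain ⟨hup, t₀, ht₀, hlow⟩ := hleg (w / N) hδ
    have hfinN : penalizedSup T K N w ≠ ∞ :=
      ne_top_of_le_ne_top hfin (penalizedSup_antitone hK hN w)
    have hpos : 0 < (penalizedSup T K N w).toReal :=
      ENNReal.toReal_pos ((ENNReal.ofReal_pos.2 (Real.exp_pos _)).trans_le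
        (le_penalizedSup ht₀)).ne' hfinN
    have hq : N * ((w / N) ^ 2 / (2 * V) - κ * (w / N) ^ 3 / (6 * V ^ 3)) =
        w ^ 2 / (2 * V) / N - κ * w ^ 3 / (6 * V ^ 3) / N ^ 2 := by field_simp
    have hr : N * (D₁ * (w / N) ^ 4) = D₁ * w ^ 4 / N ^ 3 := by field_simp
    have hle : penalizedSup T K N w ≤ ENNReal.ofReal (Real.exp
        ((w ^ 2 / (2 * V) / N - κ * w ^ 3 / (6 * V ^ 3) / N ^ 2) + D₁ * w ^ 4 / N ^ 3)) := by
      rw [penalizedSup_le_iff]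
      intro t ht
      rw [← hq, ← hr, ← mul_add]
      calc t * w - N * K t = N * (t * (w / N) - K t) := by field_simp
        _ ≤ _ := by gcongr; exact hup t ht
    have hge : ENNReal.ofReal (Real.exp
        ((w ^ 2 / (2 * V) / N - κ * w ^ 3 / (6 * V ^ 3) / N ^ 2) - D₁ * w ^ 4 / N ^ 3)) ≤
        penalizedSup T K N w := by
      refine le_trans (ENNReal.ofReal_le_ofReal (Real.exp_le_exp.2 ?_)) (le_penalizedSup ht₀)
      rw [← hq, ← hr, ← mul_sub]
      calc _ ≤ N * (t₀ * (w / N) - K t₀) := by gcongr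
        _ = _ := by field_simp
    have hle' := ENNReal.toReal_mono ENNReal.ofReal_ne_top hle
    have hge' := ENNReal.toReal_mono hfinN hge
    rw [ENNReal.toReal_ofReal (Real.exp_pos _).le] at hle' hge'
    -- The exponent is taken to be the logarithm of the supremum; the Legendre bounds at δ = w/N,
    -- multiplied by N, are the required two-sided control.
    have := hmid N w (Real.log (penalizedSup T K N w).toReal) hN1 hw (by
      rw [abs_le]
      constructor
      · linarith [(Real.le_log_iff_exp_le hpos).2 hge']
      · linarith [(Real.log_le_iff_le_exp hpos).2 hle'])
    rw [Real.exp_log hpos] at this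
    linarith
  -- For large |w| there is no cancellation: supremum and expansion are each small.
  · have h1 := htail N₀ N w hN₀ hN hw
    have h1' := ENNReal.toReal_mono (ENNReal.mul_ne_top ENNReal.ofReal_ne_top hfin) h1
    rw [ENNReal.toReal_mul, ENNReal.toReal_ofReal (Real.exp_pos _).le] at h1'
    have h2 := hout N w hN1 hw
    refine (abs_sub _ _).trans ?_
    rw [abs_of_nonneg ENNReal.toReal_nonneg]
    linarith

/-- The second order asymptotics of the mean of the penalized supremum as the penalty grows. -/
theorem tendsto_lintegral_penalizedSup {Ω : Type*} [MeasurableSpace Ω] {P : Measure Ω}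
    [IsProbabilityMeasure P] {X : Ω → ℝ} (hX : Measurable X) {T : Set ℝ} {K : ℝ → ℝ}
    (hT : T ∈ nhds 0) (hK : ∀ t ∈ T, 0 ≤ K t) {V κ C ρ₀ : ℝ} (hV : 0 < V) (hC : 0 ≤ C)
    (hρ₀ : 0 < ρ₀)
    (htaylor : ∀ t, |t| ≤ ρ₀ → |K t - (V * t ^ 2 / 2 + κ * t ^ 3 / 6)| ≤ C * t ^ 4)
    (hlin : ∀ ρ > 0, ∃ k > 0, ∀ t ∈ T, ρ ≤ |t| → k * |t| ≤ K t) {a : ℝ} (ha : 0 < a)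
    (hexp : Integrable (fun ω => Real.exp (a * |X ω|)) P) (hvar : ∫ ω, X ω ^ 2 ∂P = V)
    {N₀ : ℝ} (hN₀ : 0 ≤ N₀) (hfin : ∫⁻ ω, penalizedSup T K N₀ (X ω) ∂P ≠ ∞) :
    Filter.Tendsto
      (fun N : ℝ => N ^ 2 * ((∫⁻ ω, penalizedSup T K N (X ω) ∂P).toReal - 1 - 1 / (2 * N)))
      Filter.atTop
      (nhds ((∫ ω, X ω ^ 4 ∂P) / (8 * V ^ 2) - κ * (∫ ω, X ω ^ 3 ∂P) / (6 * V ^ 3))) := by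
  obtain ⟨D, hD, c, hc, hb⟩ :=
    abs_penalizedSup_sub_expansion_le hT hK hV hC hρ₀ htaylor hlin ha
  have hpow : ∀ k : ℕ, Integrable (fun ω => X ω ^ k) P := by
    intro k
    obtain ⟨Ck, hCk, hk⟩ := abs_pow_le_mul_exp ha k
    refine (hexp.const_mul Ck).mono' (by fun_prop) (ae_of_all _ fun ω => ?_)
    rw [Real.norm_eq_abs, abs_pow]
    exact hk _ (abs_nonneg _)
  set m₄ := ∫ ω, X ω ^ 4 ∂P
  set m₃ := ∫ ω, X ω ^ 3 ∂P
  set Q := m₄ / (8 * V ^ 2) - κ * m₃ / (6 * V ^ 3) with hQ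
  have hmeas : ∀ N, Measurable fun ω => penalizedSup T K N (X ω) :=
    fun N => (measurable_penalizedSup T K N).comp hX
  have hae : ∀ᵐ ω ∂P, penalizedSup T K N₀ (X ω) ≠ ∞ :=
    (ae_lt_top (hmeas N₀) hfin).mono fun ω h => h.ne
  have i2 : ∀ N : ℝ, Integrable (fun ω => X ω ^ 2 / (2 * V) / N) P :=
    fun N => ((hpow 2).div_const _).div_const _
  have i4 : Integrable (fun ω => X ω ^ 4 / (8 * V ^ 2)) P := (hpow 4).div_const _
  have i3 : Integrable (fun ω => κ * X ω ^ 3 / (6 * V ^ 3)) P :=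
    ((hpow 3).const_mul _).div_const _
  have i43 : ∀ N : ℝ, Integrable
      (fun ω => (X ω ^ 4 / (8 * V ^ 2) - κ * X ω ^ 3 / (6 * V ^ 3)) / N ^ 2) P :=
    fun N => (i4.sub i3).div_const _
  have i12 : ∀ N : ℝ, Integrable (fun ω => 1 + X ω ^ 2 / (2 * V) / N) P :=
    fun N => (integrable_const 1).add (i2 N)
  have hexpan : ∀ N, Integrable (fun ω => expansion V κ N (X ω)) P :=
    fun N => (i12 N).add (i43 N)
  have hexpan_int : ∀ N, ∫ ω, expansion V κ N (X ω) ∂P = 1 + 1 / (2 * N) + Q / N ^ 2 := by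
    intro N
    unfold expansion
    rw [integral_add (i12 N) (i43 N), integral_add (integrable_const _) (i2 N), integral_div,
      integral_div, integral_div, integral_sub i4 i3, integral_div, integral_div,
      integral_const_mul, hvar]
    simp only [integral_const, probReal_univ, smul_eq_mul, mul_one]
    congr 2
    field_simp
  set I₀ := (∫⁻ ω, penalizedSup T K N₀ (X ω) ∂P).toReal
  set J := ∫ ω, Real.exp (a * |X ω|) ∂P
  have hbound : ∀ N, N₀ ≤ N → 1 ≤ N →
      |(∫⁻ ω, penalizedSup T K N (X ω) ∂P).toReal - (1 + 1 / (2 * N) + Q / N ^ 2)| ≤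
        D * J / N ^ 3 + Real.exp (-(c * (N - N₀))) * I₀ := by
    intro N hN hN1
    have hfinN : ∫⁻ ω, penalizedSup T K N (X ω) ∂P ≠ ∞ :=
      ne_top_of_le_ne_top hfin (lintegral_mono fun ω => penalizedSup_antitone hK hN _)
    rw [← hexpan_int, ← integral_toReal (hmeas N).aemeasurable (ae_lt_top (hmeas N) hfinN),
      ← integral_sub (integrable_toReal_of_lintegral_ne_top (hmeas N).aemeasurable hfinN)
        (hexpan N)]
    have hI : I₀ = ∫ ω, (penalizedSup T K N₀ (X ω)).toReal ∂P :=
      (integral_toReal (hmeas N₀).aemeasurable (ae_lt_top (hmeas N₀) hfin)).symm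
    have hint₁ : Integrable (fun ω => D * Real.exp (a * |X ω|) / N ^ 3) P :=
      (hexp.const_mul D).div_const _
    have hint₂ : Integrable
        (fun ω => Real.exp (-(c * (N - N₀))) * (penalizedSup T K N₀ (X ω)).toReal) P :=
      (integrable_toReal_of_lintegral_ne_top (hmeas N₀).aemeasurable hfin).const_mul _
    refine (abs_integral_le_integral_abs).trans ?_
    calc _ ≤ ∫ ω, (D * Real.exp (a * |X ω|) / N ^ 3 +
          Real.exp (-(c * (N - N₀))) * (penalizedSup T K N₀ (X ω)).toReal) ∂P := by
          refine integral_mono_of_nonneg (ae_of_all _ fun ω => abs_nonneg _)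
            (hint₁.add hint₂) ?_
          filter_upwards [hae] with ω hω using hb N₀ N (X ω) hN₀ hN hN1 hω
      _ = _ := by
          rw [integral_add hint₁ hint₂, integral_div, integral_const_mul, integral_const_mul, hI]
  have hlim : Filter.Tendsto (fun N : ℝ => D * J * N⁻¹ +
      Real.exp (c * N₀) * I₀ * (N ^ 2 * Real.exp (-c * N))) Filter.atTop (nhds 0) := by
    have h1 : Filter.Tendsto (fun N : ℝ => N ^ 2 * Real.exp (-c * N)) Filter.atTop (nhds 0) := by
      simpa using tendsto_rpow_mul_exp_neg_mul_atTop_nhds_zero 2 c hc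
    simpa using (tendsto_inv_atTop_zero.const_mul (D * J)).add (h1.const_mul (Real.exp (c * N₀) * I₀))
  rw [tendsto_iff_norm_sub_tendsto_zero]
  refine squeeze_zero' (Filter.Eventually.of_forall fun _ => norm_nonneg _) ?_ hlim
  filter_upwards [Filter.eventually_ge_atTop N₀, Filter.eventually_ge_atTop 1] with N hN hN1
  have hN0 : 0 < N := by linarith
  have e : N ^ 2 * ((∫⁻ ω, penalizedSup T K N (X ω) ∂P).toReal - 1 - 1 / (2 * N)) - Q =
    N ^ 2 * ((∫⁻ ω, penalizedSup T K N (X ω) ∂P).toReal - (1 + 1 / (2 * N) + Q / N ^ 2)) := by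
    field_simp; ring
  rw [e, Real.norm_eq_abs, abs_mul, abs_of_pos (by positivity : 0 < N ^ 2)]
  calc _ ≤ N ^ 2 * (D * J / N ^ 3 + Real.exp (-(c * (N - N₀))) * I₀) := by
        gcongr; exact hbound N hN hN1
    _ = _ := by
        rw [show -(c * (N - N₀)) = c * N₀ + -c * N by ring, Real.exp_add]
        field_simp

/-! ### Submultiplicativity and finiteness of the penalized supremum -/

lemma penalizedSup_pos {T : Set ℝ} (hT : T.Nonempty) (K : ℝ → ℝ) (N w : ℝ) :
    0 < penalizedSup T K N w := by
  obtain ⟨t, ht⟩ := hT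
  exact (ENNReal.ofReal_pos.2 (Real.exp_pos _)).trans_le (le_penalizedSup ht)

/-- A supremum of products is at most the product of the suprema. All finiteness for longer data is
deduced from this. -/
lemma penalizedSup_add_le (T : Set ℝ) (K : ℝ → ℝ) (M N v w : ℝ) :
    penalizedSup T K (M + N) (v + w) ≤ penalizedSup T K M v * penalizedSup T K N w := by
  refine iSup₂_le fun t ht => ?_
  rw [show t * (v + w) - (M + N) * K t = (t * v - M * K t) + (t * w - N * K t) by ring,
    Real.exp_add, ENNReal.ofReal_mul (Real.exp_pos _).le]
  exact mul_le_mul' (le_penalizedSup ht) (le_penalizedSup ht)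

lemma penalizedSup_nsmul_ne_top {T : Set ℝ} {K : ℝ → ℝ} {v : ℝ}
    (h : penalizedSup T K 1 v ≠ ∞) (n : ℕ) : penalizedSup T K n (n * v) ≠ ∞ := by
  induction n with
  | zero => exact ne_top_of_le_ne_top ENNReal.one_ne_top (by simp [penalizedSup])
  | succ n ih =>
    push_cast
    rw [add_mul, one_mul]
    exact ne_top_of_le_ne_top (ENNReal.mul_ne_top ih h) (penalizedSup_add_le _ _ _ _ _ _)

/-- The exponent for n copies is n times that for one copy, hence no smaller wherever the latter is
nonnegative; elsewhere the exponential is at most 1. -/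
lemma penalizedSup_one_ne_top_of_nsmul {T : Set ℝ} {K : ℝ → ℝ} {v : ℝ} {n : ℕ} (hn : n ≠ 0)
    (h : penalizedSup T K n (n * v) ≠ ∞) : penalizedSup T K 1 v ≠ ∞ := by
  have : penalizedSup T K 1 v ≤ max 1 (penalizedSup T K n (n * v)) := by
    refine iSup₂_le fun t ht => ?_
    rcases le_total (t * v - 1 * K t) 0 with h0 | h0
    · refine le_max_of_le_left ?_
      exact ENNReal.ofReal_le_one.2 (Real.exp_le_one_iff.2 h0)
    · refine le_max_of_le_right (le_trans ?_ (le_penalizedSup ht))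
      refine ENNReal.ofReal_le_ofReal (Real.exp_le_exp.2 ?_)
      have : (1 : ℝ) ≤ n := by exact_mod_cast Nat.one_le_iff_ne_zero.2 hn
      nlinarith
  exact ne_top_of_le_ne_top (by simp [h]) this

/-! ### Likelihoods and predictions as functions of the sum -/

namespace NatExpFamily

variable (E : NatExpFamily)

instance : SigmaFinite E.base := E.sigmaFinite_base

lemma Θ_nonempty : E.Θ.Nonempty := E.interior_Θ_nonempty.mono interior_subset

/-- The integral of the maximized likelihood of `n + 1` outcomes over the last outcome, as a
function of the sum of the other outcomes. -/
noncomputable def normalizer (n : ℕ) (s : ℝ) : ℝ≥0∞ :=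
  ∫⁻ z, penalizedSup E.Θ E.A (n + 1 : ℕ) (s + z) ∂E.reference

lemma jointPdf_eq (θ : ℝ) {n : ℕ} (x : Fin n → ℝ) :
    E.jointPdf θ x = (∏ i, ENNReal.ofReal (E.h (x i))) *
      ENNReal.ofReal (Real.exp (θ * ∑ i, x i - n * E.A θ)) := by
  have : Real.exp (θ * ∑ i, x i - n * E.A θ) = ∏ i, Real.exp (θ * x i - E.A θ) := by
    rw [← Real.exp_sum, Finset.sum_sub_distrib, Finset.mul_sum]; simp
  rw [this, ENNReal.ofReal_prod_of_nonneg (fun i _ => (Real.exp_pos _).le),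
    ← Finset.prod_mul_distrib]
  refine Finset.prod_congr rfl fun i _ => ?_
  rw [pdf, ENNReal.ofReal_mul (E.h_nonneg _)]

lemma maxLik_eq {n : ℕ} (x : Fin n → ℝ) :
    E.maxLik x = (∏ i, ENNReal.ofReal (E.h (x i))) * penalizedSup E.Θ E.A n (∑ i, x i) := by
  simp only [maxLik, jointPdf_eq, penalizedSup, ENNReal.mul_iSup]

lemma lintegral_reference {f : ℝ → ℝ≥0∞} (hf : Measurable f) :
    ∫⁻ z, f z ∂E.reference = ∫⁻ z, ENNReal.ofReal (E.h z) * f z ∂E.base := by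
  rw [reference, lintegral_withDensity_eq_lintegral_mul _ E.measurable_h.ennreal_ofReal hf]
  rfl

variable {E} in
lemma prod_ofReal_h_ne_top {n : ℕ} {x : Fin n → ℝ} :
    ∏ i, ENNReal.ofReal (E.h (x i)) ≠ ∞ :=
  ENNReal.prod_ne_top fun _ _ => ENNReal.ofReal_ne_top

lemma maxLik_append_one {n : ℕ} (x : Fin n → ℝ) (z : ℝ) :
    E.maxLik (Fin.append x fun _ : Fin 1 => z) = (∏ i, ENNReal.ofReal (E.h (x i))) *
      (ENNReal.ofReal (E.h z) * penalizedSup E.Θ E.A (n + 1 : ℕ) (∑ i, x i + z)) := by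
  rw [maxLik_eq, Fin.prod_univ_add, Fin.sum_univ_add]
  simp [mul_assoc]

lemma shtarkov_one {n : ℕ} (x : Fin n → ℝ) :
    E.shtarkov x 1 = (∏ i, ENNReal.ofReal (E.h (x i))) * E.normalizer n (∑ i, x i) := by
  have hmeas : Measurable fun z : ℝ => penalizedSup E.Θ E.A (n + 1 : ℕ) (∑ i, x i + z) :=
    (measurable_penalizedSup _ _ _).comp (measurable_const_add _)
  rw [normalizer, E.lintegral_reference hmeas,
    ← lintegral_const_mul' _ _ prod_ofReal_h_ne_top, shtarkov,
    ← (measurePreserving_funUnique E.base (Fin 1)).lintegral_comp_emb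
      (MeasurableEquiv.measurableEmbedding _)]
  refine lintegral_congr fun y => ?_
  rw [← maxLik_append_one]
  congr 2
  ext i
  rw [Subsingleton.elim i default]; rfl

lemma shtarkov_zero {n : ℕ} (x : Fin n → ℝ) :
    E.shtarkov x 0 = (∏ i, ENNReal.ofReal (E.h (x i))) * penalizedSup E.Θ E.A n (∑ i, x i) := by
  rw [shtarkov, lintegral_unique, maxLik_eq]
  have : ∀ y : Fin 0 → ℝ, ∑ i, Fin.append x y i = ∑ i, x i := fun y => by
    rw [Fin.sum_univ_add]
    simp only [Fin.append_left, Finset.univ_eq_empty, Finset.sum_empty, add_zero]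
  rw [Fin.prod_univ_add, this]
  simp only [Fin.append_left, Finset.univ_eq_empty, Finset.prod_empty, mul_one, add_zero]
  simp

variable {E}

lemma prod_ofReal_h_ne_zero {n : ℕ} {x : Fin n → ℝ} (hx : ∀ i, x i ∈ E.sampleSpace) :
    ∏ i, ENNReal.ofReal (E.h (x i)) ≠ 0 :=
  Finset.prod_ne_zero_iff.2 fun i _ => (ENNReal.ofReal_pos.2 (hx i)).ne'

/-- The factors `h` of the past cancel between the maximized likelihood and its integral; this needs
the past to lie in the sample space. -/
lemma snmlNext_eq {n : ℕ} {x : Fin n → ℝ} (hx : ∀ i, x i ∈ E.sampleSpace) (z : ℝ) :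
    E.snmlNext x z = ENNReal.ofReal (E.h z) * penalizedSup E.Θ E.A (n + 1 : ℕ) (∑ i, x i + z) /
      E.normalizer n (∑ i, x i) := by
  rw [snmlNext, cnml, maxLik_append_one, shtarkov_one,
    ENNReal.mul_div_mul_left _ _ (prod_ofReal_h_ne_zero hx) prod_ofReal_h_ne_top]

/-- The sequential predictions depend on the past through its length and its sum. -/
lemma snml_eq {m k : ℕ} {x : Fin m → ℝ} (hx : ∀ i, x i ∈ E.sampleSpace) (Y : ℕ → ℝ)
    (hY : ∀ i, Y i ∈ E.sampleSpace) :
    E.snml x (fun i : Fin k => Y i) = ∏ t ∈ Finset.range k,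
      ENNReal.ofReal (E.h (Y t)) *
        penalizedSup E.Θ E.A (m + t + 1 : ℕ) (∑ i, x i + ∑ i ∈ Finset.range t, Y i + Y t) /
        E.normalizer (m + t) (∑ i, x i + ∑ i ∈ Finset.range t, Y i) := by
  rw [snml, ← Fin.prod_univ_eq_prod_range (fun t => ENNReal.ofReal (E.h (Y t)) *
        penalizedSup E.Θ E.A (m + t + 1 : ℕ) (∑ i, x i + ∑ i ∈ Finset.range t, Y i + Y t) /
        E.normalizer (m + t) (∑ i, x i + ∑ i ∈ Finset.range t, Y i))]
  refine Finset.prod_congr rfl fun t _ => ?_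
  have hmem : ∀ i, Fin.append x (fun i : Fin t => Y i) i ∈ E.sampleSpace := by
    intro i
    refine Fin.addCases (fun i => ?_) (fun i => ?_) i
    · simpa using hx i
    · simpa using hY _
  have := snmlNext_eq hmem (Y t)
  rw [Fin.sum_univ_add] at this
  simp only [Fin.append_left, Fin.append_right] at this
  rw [Fin.sum_univ_eq_sum_range] at this
  exact this

lemma normalizer_ne_zero (n : ℕ) (s : ℝ) : E.normalizer n s ≠ 0 := by
  have hmeas : Measurable fun z : ℝ => penalizedSup E.Θ E.A (n + 1 : ℕ) (s + z) :=
    (measurable_penalizedSup _ _ _).comp (measurable_const_add _)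
  rw [normalizer, Ne, lintegral_eq_zero_iff hmeas]
  intro h
  have : ∀ᵐ z ∂E.reference, False := h.mono fun z hz => (penalizedSup_pos E.Θ_nonempty _ _ _).ne' hz
  rw [ae_iff] at this
  simp only [not_false_eq_true, Set.ofPred_true, Measure.measure_univ_eq_zero] at this
  exact E.reference_ne_zero this

/-- Carries finiteness from the initial length to every longer sample. -/
lemma normalizer_add_le (n k : ℕ) (s v : ℝ) :
    E.normalizer (n + k) (s + v) ≤ E.normalizer n s * penalizedSup E.Θ E.A k v := by
  have hmeas : Measurable fun z : ℝ => penalizedSup E.Θ E.A (n + 1 : ℕ) (s + z) :=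
    (measurable_penalizedSup _ _ _).comp (measurable_const_add _)
  rw [normalizer, normalizer, ← lintegral_mul_const _ hmeas]
  refine lintegral_mono fun z => ?_
  have := penalizedSup_add_le E.Θ E.A (n + 1 : ℕ) k (s + z) v
  convert this using 2
  · push_cast; ring
  · ring

/-! ### Consequences of exchangeability -/

/-- Swapping the last two of the outcomes in an exchangeable SNML strategy. -/
lemma div_normalizer_eq_of_swap {m : ℕ} (hex : E.SNMLExchangeable m) {k : ℕ} {x : Fin m → ℝ}
    (hx : ∀ i, x i ∈ E.sampleSpace) {Y : ℕ → ℝ} (hY : ∀ i, Y i ∈ E.sampleSpace)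
    (hL : ∀ t, penalizedSup E.Θ E.A (m + t + 1 : ℕ)
      (∑ i, x i + ∑ i ∈ Finset.range t, Y i + Y t) ≠ ∞)
    (hZ : ∀ t, E.normalizer (m + t) (∑ i, x i + ∑ i ∈ Finset.range t, Y i) ≠ ∞)
    {a b s : ℝ} (ha : a ∈ E.sampleSpace) (hb : b ∈ E.sampleSpace)
    (hs : s = ∑ i, x i + ∑ i ∈ Finset.range k, Y i)
    (hLab : penalizedSup E.Θ E.A (m + k + 1 + 1 : ℕ) (s + a + b) ≠ ∞) :
    penalizedSup E.Θ E.A (m + k + 1 : ℕ) (s + a) / E.normalizer (m + k + 1) (s + a) =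
      penalizedSup E.Θ E.A (m + k + 1 : ℕ) (s + b) / E.normalizer (m + k + 1) (s + b) := by
  let W : ℝ → ℝ → ℕ → ℝ := fun a b i => if i < k then Y i else if i = k then a else b
  have hW : ∀ a b, a ∈ E.sampleSpace → b ∈ E.sampleSpace → ∀ i, W a b i ∈ E.sampleSpace := by
    intro a b ha hb i
    simp only [W]
    split_ifs
    exacts [hY i, ha, hb]
  have hWlt : ∀ a b i, i < k → W a b i = Y i := fun a b i hi => by simp [W, hi]
  have hWsum : ∀ a b t, t ≤ k → ∑ i ∈ Finset.range t, W a b i = ∑ i ∈ Finset.range t, Y i :=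
    fun a b t ht => Finset.sum_congr rfl fun i hi =>
      hWlt a b i ((Finset.mem_range.1 hi).trans_le ht)
  have hWk : ∀ a b, W a b k = a := fun a b => by simp [W]
  have hWk1 : ∀ a b, W a b (k + 1) = b := fun a b => by simp [W]
  set S := ∏ t ∈ Finset.range k, ENNReal.ofReal (E.h (Y t)) *
        penalizedSup E.Θ E.A (m + t + 1 : ℕ) (∑ i, x i + ∑ i ∈ Finset.range t, Y i + Y t) /
        E.normalizer (m + t) (∑ i, x i + ∑ i ∈ Finset.range t, Y i) with hS
  have hS0 : S ≠ 0 := Finset.prod_ne_zero_iff.2 fun t _ =>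
    ENNReal.div_ne_zero.2 ⟨mul_ne_zero (ENNReal.ofReal_pos.2 (hY t)).ne'
      (penalizedSup_pos E.Θ_nonempty _ _ _).ne', hZ t⟩
  have hStop : S ≠ ∞ := ENNReal.prod_ne_top fun t _ =>
    ENNReal.div_ne_top (ENNReal.mul_ne_top ENNReal.ofReal_ne_top (hL t)) (normalizer_ne_zero _ _)
  have expand : ∀ a b, a ∈ E.sampleSpace → b ∈ E.sampleSpace →
      E.snml x (fun i : Fin (k + 2) => W a b i) =
        S * (ENNReal.ofReal (E.h a) * penalizedSup E.Θ E.A (m + k + 1 : ℕ) (s + a) /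
          E.normalizer (m + k) s) *
        (ENNReal.ofReal (E.h b) * penalizedSup E.Θ E.A (m + k + 1 + 1 : ℕ) (s + a + b) /
          E.normalizer (m + k + 1) (s + a)) := by
    intro a b ha hb
    rw [snml_eq hx _ (hW a b ha hb), Finset.prod_range_succ, Finset.prod_range_succ,
      Finset.sum_range_succ, hWsum a b k le_rfl, hWk, hWk1, ← add_assoc (∑ i, x i), ← hs]
    congr 2
    refine Finset.prod_congr rfl fun t ht => ?_
    rw [hWlt a b t (Finset.mem_range.1 ht), hWsum a b t (Finset.mem_range.1 ht).le]
  have hswap := hex (k + 2) x (fun i : Fin (k + 2) => W a b i) hx (fun i => hW a b ha hb i)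
    (Equiv.swap ⟨k, by omega⟩ ⟨k + 1, by omega⟩)
  have hcomp : (fun i : Fin (k + 2) => W a b i) ∘
      (Equiv.swap ⟨k, by omega⟩ ⟨k + 1, by omega⟩ : Equiv.Perm (Fin (k + 2))) =
      fun i : Fin (k + 2) => W b a i := by
    funext i
    simp only [Function.comp_apply]
    rcases lt_or_ge (i : ℕ) k with hi | hi
    · rw [Equiv.swap_apply_of_ne_of_ne (Fin.ne_of_val_ne (by simp; omega))
        (Fin.ne_of_val_ne (by simp; omega)), hWlt _ _ _ hi, hWlt _ _ _ hi]
    · rcases hi.eq_or_lt with hi | hi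
      · have : i = ⟨k, by omega⟩ := Fin.ext hi.symm
        rw [this, Equiv.swap_apply_left]
        simp only [hWk, hWk1]
      · have : i = ⟨k + 1, by omega⟩ := Fin.ext (by have := i.isLt; simp; omega)
        rw [this, Equiv.swap_apply_right]
        simp only [hWk, hWk1]
  rw [hcomp, expand a b ha hb, expand b a hb ha, add_right_comm s b a] at hswap
  set L := penalizedSup E.Θ E.A (m + k + 1 + 1 : ℕ) (s + a + b)
  have hZk : E.normalizer (m + k) s ≠ ∞ := hs ▸ hZ k
  -- The factor common to both orders. Cancelling it requires it to be neither 0 nor ∞, which is the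
  -- purpose of `hL`, `hZ` and `hLab`.
  set c := S * ENNReal.ofReal (E.h a) * ENNReal.ofReal (E.h b) * L * (E.normalizer (m + k) s)⁻¹
  have hc0 : c ≠ 0 := mul_ne_zero (mul_ne_zero (mul_ne_zero (mul_ne_zero hS0
    (ENNReal.ofReal_pos.2 ha).ne') (ENNReal.ofReal_pos.2 hb).ne')
    (penalizedSup_pos E.Θ_nonempty _ _ _).ne') (ENNReal.inv_ne_zero.2 hZk)
  have hctop : c ≠ ∞ := ENNReal.mul_ne_top (ENNReal.mul_ne_top (ENNReal.mul_ne_top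
    (ENNReal.mul_ne_top hStop ENNReal.ofReal_ne_top) ENNReal.ofReal_ne_top) hLab)
    (ENNReal.inv_ne_top.2 (normalizer_ne_zero _ _))
  rw [← ENNReal.mul_right_inj hc0 hctop]
  simp only [div_eq_mul_inv, c] at hswap ⊢
  calc _ = _ := by ring
    _ = _ := hswap.symm
    _ = _ := by ring

/-- For an exchangeable SNML strategy, the ratio of the normalizer to the maximized likelihood of
a sequence of `a`s and `b`s does not depend on the number of `b`s, provided that the sequence
contains at least `m` times `a`. -/
lemma div_normalizer_eq {m : ℕ} (hex : E.SNMLExchangeable m) {a b : ℝ}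
    (ha : a ∈ E.sampleSpace) (hb : b ∈ E.sampleSpace)
    (hLa : penalizedSup E.Θ E.A 1 a ≠ ∞) (hLb : penalizedSup E.Θ E.A 1 b ≠ ∞)
    (hZ : E.normalizer m (m * a) ≠ ∞) (k j : ℕ) (hj : j ≤ k + 1) :
    penalizedSup E.Θ E.A (m + k + 1 : ℕ) ((m + k + 1 : ℕ) * a + j * (b - a)) /
        E.normalizer (m + k + 1) ((m + k + 1 : ℕ) * a + j * (b - a)) =
      penalizedSup E.Θ E.A (m + k + 1 : ℕ) ((m + k + 1 : ℕ) * a) /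
        E.normalizer (m + k + 1) ((m + k + 1 : ℕ) * a) := by
  induction j with
  | zero => simp
  | succ j ih =>
    rw [← ih (by omega)]
    let Y : ℕ → ℝ := fun i => if i < j then b else a
    have hYsum : ∀ t, ∃ p q : ℕ, p + q = t ∧ ∑ i ∈ Finset.range t, Y i = p * a + q * b := by
      intro t
      induction t with
      | zero => exact ⟨0, 0, rfl, by simp⟩
      | succ t iht =>
        obtain ⟨p, q, hpq, h⟩ := iht
        rw [Finset.sum_range_succ, h]
        by_cases ht : t < j
        · exact ⟨p, q + 1, by omega, by simp [Y, ht]; ring⟩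
        · exact ⟨p + 1, q, by omega, by simp [Y, ht]; ring⟩
    have hL : ∀ p q : ℕ, penalizedSup E.Θ E.A (p + q : ℕ) (p * a + q * b) ≠ ∞ := fun p q => by
      push_cast
      exact ne_top_of_le_ne_top (ENNReal.mul_ne_top (penalizedSup_nsmul_ne_top hLa p)
        (penalizedSup_nsmul_ne_top hLb q)) (penalizedSup_add_le _ _ _ _ _ _)
    have hYk : ∑ i ∈ Finset.range k, Y i = (k - j) * a + j * b := by
      obtain ⟨d, rfl⟩ := Nat.exists_eq_add_of_le (show j ≤ k by omega)
      rw [Finset.sum_range_add, Finset.sum_congr rfl (g := fun _ => b)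
        (fun i hi => if_pos (Finset.mem_range.1 hi))]
      simp [Y]; ring
    -- The prefix has m initial copies of a, then j copies of b and k - j of a. Appending a or b
    -- gives j or j + 1 copies of b among m + k + 1 outcomes.
    have := div_normalizer_eq_of_swap hex (k := k) (x := fun _ : Fin m => a) (Y := Y) (a := a)
      (b := b) (s := m * a + ((k - j) * a + j * b)) (fun _ => ha)
      (fun i => by simp only [Y]; split_ifs <;> assumption) ?_ ?_ ha hb (by simp [hYk]) ?_
    · convert this.symm using 2 <;> (push_cast; ring_nf)
    · intro t
      obtain ⟨p, q, hpq, h⟩ := hYsum (t + 1)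
      rw [add_assoc (∑ i : Fin m, a), ← Finset.sum_range_succ, h]
      convert hL (m + p) q using 2
      · rw [add_assoc, add_assoc, hpq]
      · simp; ring
    · intro t
      obtain ⟨p, q, hpq, h⟩ := hYsum t
      rw [h]
      have := normalizer_add_le (E := E) m t (m * a) (p * a + q * b)
      refine ne_top_of_le_ne_top (ENNReal.mul_ne_top hZ (hpq ▸ hL p q)) ?_
      simpa using this
    · obtain ⟨d, rfl⟩ := Nat.exists_eq_add_of_le (show j ≤ k by omega)
      convert hL (m + d + 1) (j + 1) using 2
      · congr 1; omega
      · push_cast; ring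

/-! ### Finiteness from the initial length condition -/

lemma normalizer_ne_top_of_counts {m : ℕ} {a b : ℝ}
    (hLa : penalizedSup E.Θ E.A 1 a ≠ ∞) (hLb : penalizedSup E.Θ E.A 1 b ≠ ∞)
    (hZ : E.normalizer m (m * a) ≠ ∞) (k j : ℕ) (hj : j ≤ k) :
    E.normalizer (m + k) ((m + k : ℕ) * a + j * (b - a)) ≠ ∞ := by
  obtain ⟨d, rfl⟩ := Nat.exists_eq_add_of_le hj
  have h1 := penalizedSup_add_le E.Θ E.A j d (j * b) (d * a)
  have h2 := normalizer_add_le (E := E) m (j + d) (m * a) (j * b + d * a)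
  have h3 := ENNReal.mul_ne_top (penalizedSup_nsmul_ne_top hLb j) (penalizedSup_nsmul_ne_top hLa d)
  refine ne_top_of_le_ne_top (ENNReal.mul_ne_top hZ (ne_top_of_le_ne_top h3 h1)) ?_
  rw [Nat.cast_add j d] at h2
  convert h2 using 1
  congr 1
  push_cast; ring_nf

lemma IsInitialLength.normalizer_ne_top {m : ℕ} (hm : E.IsInitialLength m) {a : ℝ}
    (ha : a ∈ E.sampleSpace) : E.normalizer m (m * a) ≠ ∞ := by
  have := ((hm (fun _ => a) fun _ => ha).2 1).ne
  rw [shtarkov_one] at this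
  intro h
  apply this
  rw [show ∑ i : Fin m, a = m * a by simp, h, ENNReal.mul_top (prod_ofReal_h_ne_zero fun _ => ha)]

lemma ae_reference_mem_sampleSpace : ∀ᵐ x ∂E.reference, x ∈ E.sampleSpace := by
  rw [reference, ae_withDensity_iff E.measurable_h.ennreal_ofReal]
  refine ae_of_all _ fun x hx => ?_
  simpa [sampleSpace] using hx

/-- For m = 0 the supremum is the integrand of the finite horizon-one Shtarkov integral, hence
finite almost everywhere. For m > 0 the horizon-zero condition at m copies of x gives it at each x
in the sample space. -/
lemma IsInitialLength.ae_penalizedSup_ne_top {m : ℕ} (hm : E.IsInitialLength m) :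
    ∀ᵐ x ∂E.reference, penalizedSup E.Θ E.A 1 x ≠ ∞ := by
  rcases Nat.eq_zero_or_pos m with rfl | hpos
  · have := ((hm (fun i => i.elim0) fun i => i.elim0).2 1).ne
    rw [shtarkov_one, normalizer] at this
    simp only [Finset.univ_eq_empty, Finset.prod_empty, Finset.sum_empty, one_mul, zero_add,
      Nat.cast_one] at this
    exact (ae_lt_top (measurable_penalizedSup _ _ _) this).mono fun x hx => hx.ne
  · filter_upwards [ae_reference_mem_sampleSpace] with a ha
    have := ((hm (fun _ => a) fun _ => ha).2 0).ne
    rw [shtarkov_zero] at this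
    refine penalizedSup_one_ne_top_of_nsmul hpos.ne' fun h => this ?_
    rw [show ∑ i : Fin m, a = m * a by simp, h,
      ENNReal.mul_top (prod_ofReal_h_ne_zero fun _ => ha)]

/-! ### Exponential tilting, cumulants and the centred cumulant generating function -/

instance : NeZero E.reference := ⟨E.reference_ne_zero⟩

instance : SigmaFinite E.reference :=
  inferInstanceAs (SigmaFinite (E.base.withDensity fun x => ENNReal.ofReal (E.h x)))

variable (E) in
/-- The full natural parameter space. -/
def fullParams : Set ℝ := integrableExpSet (fun x : ℝ => x) E.reference

lemma mem_fullParams {θ : ℝ} (hθ : θ ∈ E.Θ) : θ ∈ E.fullParams := E.Θ_subset_full hθ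

lemma mem_interior_fullParams {θ : ℝ} (hθ : θ ∈ interior E.Θ) : θ ∈ interior E.fullParams :=
  interior_mono E.Θ_subset_full hθ

lemma integrable_exp {θ : ℝ} (hθ : θ ∈ E.fullParams) :
    Integrable (fun x => Real.exp (θ * x)) E.reference := hθ

lemma exp_A {θ : ℝ} (hθ : θ ∈ E.fullParams) :
    Real.exp (E.A θ) = ∫ x, Real.exp (θ * x) ∂E.reference :=
  exp_cgf (X := fun x : ℝ => x) hθ

lemma dist_eq_withDensity (θ : ℝ) :
    E.dist θ = E.reference.withDensity fun x => ENNReal.ofReal (Real.exp (θ * x - E.A θ)) := by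
  rw [reference, ← withDensity_mul _ E.measurable_h.ennreal_ofReal (by fun_prop), dist]
  congr 1
  funext x
  simp only [pdf, Pi.mul_apply]
  rw [ENNReal.ofReal_mul (E.h_nonneg x)]

lemma dist_eq_tilted {θ : ℝ} (hθ : θ ∈ E.fullParams) :
    E.dist θ = E.reference.tilted fun x => θ * x := by
  rw [dist_eq_withDensity, Measure.tilted]
  congr 1
  funext x
  rw [Real.exp_sub, exp_A hθ]

lemma isProbabilityMeasure_dist {θ : ℝ} (hθ : θ ∈ E.fullParams) :
    IsProbabilityMeasure (E.dist θ) := by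
  rw [dist_eq_tilted hθ]
  exact isProbabilityMeasure_tilted hθ

lemma reference_absolutelyContinuous_dist {θ : ℝ} (hθ : θ ∈ E.fullParams) :
    E.reference ≪ E.dist θ := by
  rw [dist_eq_tilted hθ]
  exact absolutelyContinuous_tilted hθ

lemma integral_dist {θ : ℝ} (hθ : θ ∈ E.fullParams) (f : ℝ → ℝ) :
    ∫ x, f x ∂E.dist θ = ∫ x, Real.exp (θ * x - E.A θ) * f x ∂E.reference := by
  rw [dist_eq_tilted hθ]
  exact integral_tilted_mul_eq_cgf (X := fun x : ℝ => x) f hθ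

lemma integrable_dist_iff {θ : ℝ} (hθ : θ ∈ E.fullParams) (f : ℝ → ℝ) :
    Integrable f (E.dist θ) ↔ Integrable (fun x => Real.exp (θ * x) * f x) E.reference := by
  rw [dist_eq_tilted hθ]
  exact integrable_tilted_iff hθ f

lemma mean_eq_deriv {θ : ℝ} (hθ : θ ∈ interior E.fullParams) : E.mean θ = deriv E.A θ := by
  rw [mean, dist_eq_tilted (interior_subset hθ)]
  exact integral_tilted_mul_self (X := fun x : ℝ => x) hθ

lemma variance_eq_iteratedDeriv {θ : ℝ} (hθ : θ ∈ interior E.fullParams) :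
    variance (fun x : ℝ => x) (E.dist θ) = iteratedDeriv 2 E.A θ := by
  rw [dist_eq_tilted (interior_subset hθ)]
  exact variance_tilted_mul (X := fun x : ℝ => x) hθ

lemma analyticAt_A {θ : ℝ} (hθ : θ ∈ interior E.fullParams) : AnalyticAt ℝ E.A θ :=
  analyticAt_cgf (X := fun x : ℝ => x) hθ

lemma analyticAt_iteratedDeriv_A {θ : ℝ} (hθ : θ ∈ interior E.fullParams) (k : ℕ) :
    AnalyticAt ℝ (iteratedDeriv k E.A) θ := by
  rw [iteratedDeriv_eq_iterate]
  exact (analyticAt_A hθ).iterated_deriv k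

lemma hasDerivAt_iteratedDeriv_A {θ : ℝ} (hθ : θ ∈ interior E.fullParams) (k : ℕ) :
    HasDerivAt (iteratedDeriv k E.A) (iteratedDeriv (k + 1) E.A θ) θ := by
  rw [iteratedDeriv_succ]
  exact (analyticAt_iteratedDeriv_A hθ k).differentiableAt.hasDerivAt

variable (E) in
/-- The centred cumulant generating function of the member with parameter `θ`. -/
noncomputable def centeredCgf (θ t : ℝ) : ℝ := E.A (θ + t) - E.A θ - t * E.mean θ

@[simp] lemma centeredCgf_zero (θ : ℝ) : E.centeredCgf θ 0 = 0 := by simp [centeredCgf]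

lemma exp_centered_eq (θ t x : ℝ) :
    Real.exp (θ * x - E.A θ) * Real.exp (t * (x - E.mean θ)) =
      Real.exp (-E.A θ - t * E.mean θ) * Real.exp ((θ + t) * x) := by
  rw [← Real.exp_add, ← Real.exp_add]; ring_nf

lemma integrable_exp_centered {θ t : ℝ} (hθ : θ ∈ E.fullParams) (ht : θ + t ∈ E.fullParams) :
    Integrable (fun x => Real.exp (t * (x - E.mean θ))) (E.dist θ) := by
  rw [integrable_dist_iff hθ]
  have := (integrable_exp ht).const_mul (Real.exp (-t * E.mean θ))
  refine this.congr (ae_of_all _ fun x => ?_)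
  simp only
  rw [← Real.exp_add, ← Real.exp_add]; ring_nf

lemma integral_exp_centered {θ t : ℝ} (hθ : θ ∈ E.fullParams) (ht : θ + t ∈ E.fullParams) :
    ∫ x, Real.exp (t * (x - E.mean θ)) ∂E.dist θ = Real.exp (E.centeredCgf θ t) := by
  rw [integral_dist hθ]
  simp only [exp_centered_eq]
  rw [integral_const_mul, ← exp_A ht, ← Real.exp_add, centeredCgf]
  ring_nf

lemma zero_mem_interior_centered {θ : ℝ} (hθ : θ ∈ interior E.fullParams) :
    (0 : ℝ) ∈ interior (integrableExpSet (fun x => x - E.mean θ) (E.dist θ)) := by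
  rw [mem_interior_iff_mem_nhds]
  have : ∀ᶠ t in nhds (0 : ℝ), θ + t ∈ E.fullParams := by
    have hc : ContinuousAt (fun t : ℝ => θ + t) 0 := by fun_prop
    exact hc.eventually (by simpa using mem_interior_iff_mem_nhds.1 hθ)
  filter_upwards [this] with t ht using integrable_exp_centered (interior_subset hθ) ht

lemma integrable_id_dist {θ : ℝ} (hθ : θ ∈ interior E.fullParams) :
    Integrable (fun x : ℝ => x) (E.dist θ) := by
  rw [dist_eq_tilted (interior_subset hθ)]
  exact memLp_one_iff_integrable.1 (memLp_tilted_mul (X := fun x : ℝ => x) hθ 1)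

/-- Integrate 1 + y ≤ e^y at y = t(x - μ). No differentiability at θ + t is used, so end points of
the full parameter space are covered. -/
lemma centeredCgf_nonneg {θ t : ℝ} (hθ : θ ∈ interior E.fullParams)
    (ht : θ + t ∈ E.fullParams) : 0 ≤ E.centeredCgf θ t := by
  have := isProbabilityMeasure_dist (interior_subset hθ)
  rw [← Real.one_le_exp_iff, ← integral_exp_centered (interior_subset hθ) ht]
  have hint : Integrable (fun x => t * (x - E.mean θ)) (E.dist θ) :=
    ((integrable_id_dist hθ).sub (integrable_const _)).const_mul t
  calc (1 : ℝ) = ∫ x, (1 + t * (x - E.mean θ)) ∂E.dist θ := by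
        rw [integral_add (integrable_const _) hint, integral_const_mul,
          integral_sub (integrable_id_dist hθ) (integrable_const _)]
        simp [mean]
    _ ≤ _ := integral_mono ((integrable_const _).add hint)
        (integrable_exp_centered (interior_subset hθ) ht) fun x => by
          simp only; linarith [Real.add_one_le_exp (t * (x - E.mean θ))]

/-- Convexity along a ray from 0, again including end points: integrate e^{ly} ≤ (1 - l) + l e^y at
y = t(x - μ) - K(t), where e^y has mean 1. -/
lemma centeredCgf_mul_le {θ t l : ℝ} (hθ : θ ∈ interior E.fullParams)
    (ht : θ + t ∈ E.fullParams) (h0 : 0 ≤ l) (h1 : l ≤ 1) :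
    E.centeredCgf θ (l * t) ≤ l * E.centeredCgf θ t := by
  have hθ' := interior_subset hθ
  have := isProbabilityMeasure_dist hθ'
  have hlt : θ + l * t ∈ E.fullParams := by
    have := convex_integrableExpSet.add_smul_sub_mem hθ' ht ⟨h0, h1⟩
    simpa [fullParams] using this
  set k := E.centeredCgf θ t
  rw [← sub_nonpos, ← Real.exp_le_one_iff, Real.exp_sub, ← integral_exp_centered hθ' hlt,
    ← integral_div]
  have hint := integrable_exp_centered hθ' ht
  calc _ ≤ ∫ x, ((1 - l) + l * (Real.exp (t * (x - E.mean θ)) / Real.exp k)) ∂E.dist θ := by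
        refine integral_mono ((integrable_exp_centered hθ' hlt).div_const _)
          ((integrable_const _).add ((hint.div_const _).const_mul _)) fun x => ?_
        simp only
        rw [← Real.exp_sub, ← Real.exp_sub]
        have := convexOn_exp.2 (Set.mem_univ 0) (Set.mem_univ (t * (x - E.mean θ) - k))
          (sub_nonneg.2 h1) h0 (by ring)
        simp only [smul_eq_mul, mul_zero, zero_add, Real.exp_zero, mul_one] at this
        convert this using 2
        ring
    _ = 1 := by
        rw [integral_add (integrable_const _) ((hint.div_const _).const_mul _),
          integral_const_mul, integral_div, integral_exp_centered hθ' ht,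
          div_self (Real.exp_pos _).ne']
        simp

/-- The reference measure is not concentrated at a point. -/
def Nondegenerate (E : NatExpFamily) : Prop := ∀ c : ℝ, ¬ ∀ᵐ x ∂E.reference, x = c

lemma iteratedDeriv_two_A_pos (hE : E.Nondegenerate) {θ : ℝ} (hθ : θ ∈ interior E.fullParams) :
    0 < iteratedDeriv 2 E.A θ := by
  rw [← variance_eq_iteratedDeriv hθ]
  refine (variance_nonneg _ _).lt_of_ne fun h => hE (E.mean θ) ?_
  have := isProbabilityMeasure_dist (interior_subset hθ)
  have hL2 : MemLp (fun x : ℝ => x) 2 (E.dist θ) := by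
    rw [dist_eq_tilted (interior_subset hθ)]
    exact memLp_tilted_mul (X := fun x : ℝ => x) hθ 2
  have h2 : evariance (fun x : ℝ => x) (E.dist θ) = 0 := by
    rw [← hL2.ofReal_variance_eq, ← h, ENNReal.ofReal_zero]
  rw [evariance_eq_zero_iff (by fun_prop)] at h2
  exact reference_absolutelyContinuous_dist (interior_subset hθ) h2

/-- Centring removes the constant and linear terms from the power series of `A`, which is analytic
at interior parameters. -/
lemma exists_centeredCgf_taylor {θ : ℝ} (hθ : θ ∈ interior E.fullParams) :
    ∃ C ≥ 0, ∃ ρ > 0, ∀ t, |t| ≤ ρ → |E.centeredCgf θ t -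
      (iteratedDeriv 2 E.A θ * t ^ 2 / 2 + iteratedDeriv 3 E.A θ * t ^ 3 / 6)| ≤ C * t ^ 4 := by
  obtain ⟨C, hC⟩ := ((analyticAt_A hθ).hasFPowerSeriesAt.isBigO_sub_partialSum_pow 4).bound
  obtain ⟨r, hr, hball⟩ := Metric.eventually_nhds_iff.1 hC
  refine ⟨max C 0, le_max_right _ _, r / 2, by positivity, fun t ht => ?_⟩
  have := hball (y := t) (by rw [Real.dist_eq, sub_zero]; linarith)
  simp only [Real.norm_eq_abs, abs_pow, (show Even 4 by decide).pow_abs] at this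
  refine le_trans (le_of_eq ?_) (this.trans (by gcongr; exact le_max_left _ _))
  congr 1
  simp only [FormalMultilinearSeries.partialSum, Finset.sum_range_succ, Finset.sum_range_zero,
    FormalMultilinearSeries.ofScalars_apply_eq, smul_eq_mul, centeredCgf, mean_eq_deriv hθ,
    iteratedDeriv_zero, iteratedDeriv_one]
  norm_num [Nat.factorial]
  ring

/-- By convexity K(t)/|t| does not decrease along rays from 0, so the quadratic lower bound at
distance r propagates outwards with slope Vr/4. -/
lemma exists_centeredCgf_linear_lower_bound (hE : E.Nondegenerate) {θ : ℝ}
    (hθ : θ ∈ interior E.fullParams) :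
    ∀ ρ > 0, ∃ k > 0, ∀ t, θ + t ∈ E.fullParams → ρ ≤ |t| → k * |t| ≤ E.centeredCgf θ t := by
  intro ρ hρ
  obtain ⟨C, hC, ρ₀, hρ₀, htay⟩ := exists_centeredCgf_taylor hθ
  have hV := iteratedDeriv_two_A_pos hE hθ
  obtain ⟨ρ₁, hρ₁, -, hq⟩ := exists_quadratic_lower_bound hV hC hρ₀ htay
  set V := iteratedDeriv 2 E.A θ
  set r := min ρ ρ₁
  have hr : 0 < r := lt_min hρ hρ₁
  refine ⟨V * r / 4, by positivity, fun t ht hρt => ?_⟩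
  have ht0 : 0 < |t| := hρ.trans_le hρt
  have h1 := centeredCgf_mul_le hθ ht (l := r / |t|) (by positivity)
    ((div_le_one ht0).2 ((min_le_left _ _).trans hρt))
  have habs : |r / |t| * t| = r := by
    rw [abs_mul, abs_div, abs_abs, abs_of_pos hr]; field_simp
  have h2 := hq (r / |t| * t) (habs.le.trans (min_le_right _ _))
  rw [← sq_abs, habs] at h2
  have h3 := h2.trans h1
  rw [div_mul_eq_mul_div, le_div_iff₀ ht0] at h3
  have : V * r ^ 2 / 4 * |t| = r * (V * r / 4 * |t|) := by ring
  rw [this] at h3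
  exact le_of_mul_le_mul_left h3 hr

/-- The second, third and fourth central moments in terms of the cumulants. -/
lemma integral_centered_pow {θ : ℝ} (hθ : θ ∈ interior E.fullParams) :
    ∫ x, (x - E.mean θ) ^ 2 ∂E.dist θ = iteratedDeriv 2 E.A θ ∧
    ∫ x, (x - E.mean θ) ^ 3 ∂E.dist θ = iteratedDeriv 3 E.A θ ∧
    ∫ x, (x - E.mean θ) ^ 4 ∂E.dist θ =
      iteratedDeriv 4 E.A θ + 3 * iteratedDeriv 2 E.A θ ^ 2 := by
  set M := mgf (fun x => x - E.mean θ) (E.dist θ) with hM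
  have hmom : ∀ n, iteratedDeriv n M 0 = ∫ x, (x - E.mean θ) ^ n ∂E.dist θ := fun n => by
    rw [hM, iteratedDeriv_mgf_zero (zero_mem_interior_centered hθ)]; rfl
  set μ := E.mean θ with hμ
  let a : ℕ → ℝ → ℝ := fun k t => iteratedDeriv k E.A (θ + t)
  have hnear : ∀ᶠ t in nhds (0 : ℝ), θ + t ∈ interior E.fullParams := by
    have hc : ContinuousAt (fun t : ℝ => θ + t) 0 := by fun_prop
    exact hc.eventually (by simpa using isOpen_interior.mem_nhds hθ)
  have ha : ∀ k, ∀ t, θ + t ∈ interior E.fullParams → HasDerivAt (a k) (a (k + 1) t) t :=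
    fun k t ht => (hasDerivAt_iteratedDeriv_A ht k).comp_const_add θ t
  -- Near 0 the centred moment generating function is the exponential of K. Each derivative is `F`
  -- times a polynomial in derivatives of K, whose values at 0 are the cumulants.
  let F : ℝ → ℝ := fun t => Real.exp (E.centeredCgf θ t)
  have e0 : M =ᶠ[nhds 0] F := by
    filter_upwards [hnear] with t ht using
      integral_exp_centered (interior_subset hθ) (interior_subset ht)
  have hF : ∀ t, θ + t ∈ interior E.fullParams → HasDerivAt F ((a 1 t - μ) * F t) t := by
    intro t ht
    have h0 : HasDerivAt (fun t => E.A (θ + t)) (a 1 t) t := by simpa [a] using ha 0 t ht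
    have h := ((h0.sub_const (E.A θ)).sub ((hasDerivAt_id t).mul_const μ)).exp
    simp only [one_mul] at h
    rw [mul_comm]
    exact h
  have e1 : iteratedDeriv 1 M =ᶠ[nhds 0] fun t => (a 1 t - μ) * F t := by
    rw [iteratedDeriv_one]
    exact e0.deriv.trans (hnear.mono fun t ht => (hF t ht).deriv)
  have e2 : iteratedDeriv 2 M =ᶠ[nhds 0] fun t => (a 2 t + (a 1 t - μ) ^ 2) * F t := by
    rw [iteratedDeriv_succ]
    refine e1.deriv.trans (hnear.mono fun t ht => ?_)
    refine (((ha 1 t ht).sub_const μ).mul (hF t ht)).deriv.trans ?_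
    ring
  have e3 : iteratedDeriv 3 M =ᶠ[nhds 0]
      fun t => (a 3 t + 3 * (a 1 t - μ) * a 2 t + (a 1 t - μ) ^ 3) * F t := by
    rw [iteratedDeriv_succ]
    refine e2.deriv.trans (hnear.mono fun t ht => ?_)
    refine (((ha 2 t ht).add (((ha 1 t ht).sub_const μ).pow 2)).mul (hF t ht)).deriv.trans ?_
    simp only [Pi.add_apply, Pi.pow_apply]
    push_cast
    ring
  have h4 : HasDerivAt (fun t => (a 3 t + 3 * (a 1 t - μ) * a 2 t + (a 1 t - μ) ^ 3) * F t) _ 0 :=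
    have h0 : θ + 0 ∈ interior E.fullParams := by simpa using hθ
    (((ha 3 0 h0).add ((((ha 1 0 h0).sub_const μ).const_mul 3).mul (ha 2 0 h0))).add
      (((ha 1 0 h0).sub_const μ).pow 3)).mul (hF 0 h0)
  have hF0 : F 0 = 1 := by simp [F]
  have ha1 : a 1 0 = μ := by simp [a, hμ, mean_eq_deriv hθ]
  have hak : ∀ k, a k 0 = iteratedDeriv k E.A θ := fun k => by simp [a]
  refine ⟨?_, ?_, ?_⟩
  · rw [← hmom, e2.eq_of_nhds, hF0, ha1, hak]; ring
  · rw [← hmom, e3.eq_of_nhds, hF0, ha1, hak]; ring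
  · rw [← hmom, iteratedDeriv_succ, e3.deriv_eq, h4.deriv]
    simp only [Pi.add_apply, Pi.pow_apply, Pi.mul_apply, hF0, ha1, hak]
    ring

/-! ### The ratio of normalizer and maximized likelihood as an expectation -/

/-- The maximized likelihood in terms of the centred cumulant generating function. -/
lemma penalizedSup_eq_mul (θ N w : ℝ) :
    penalizedSup E.Θ E.A N (N * E.mean θ + w) =
      ENNReal.ofReal (Real.exp (N * (θ * E.mean θ - E.A θ) + θ * w)) *
        penalizedSup ((θ + ·) ⁻¹' E.Θ) (E.centeredCgf θ) N w := by
  simp only [penalizedSup, ENNReal.mul_iSup]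
  refine ((Equiv.addLeft θ).iSup_congr fun t => ?_).symm
  refine iSup_congr_Prop Iff.rfl fun _ => ?_
  rw [← ENNReal.ofReal_mul (Real.exp_pos _).le, ← Real.exp_add, centeredCgf]
  simp only [Equiv.coe_addLeft]
  ring_nf

/-- At the sum Nμ the maximum likelihood is attained at θ itself, because K ≥ 0 = K(0). -/
lemma penalizedSup_mean {θ : ℝ} (hθ : θ ∈ interior E.Θ) {N : ℝ} (hN : 0 ≤ N) :
    penalizedSup E.Θ E.A N (N * E.mean θ) =
      ENNReal.ofReal (Real.exp (N * (θ * E.mean θ - E.A θ))) := by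
  have h := penalizedSup_eq_mul (E := E) θ N 0
  rw [add_zero, mul_zero, add_zero] at h
  rw [h]
  have h1 : penalizedSup ((θ + ·) ⁻¹' E.Θ) (E.centeredCgf θ) N 0 = 1 := by
    refine le_antisymm ?_ ?_
    · rw [← ENNReal.ofReal_one, ← Real.exp_zero, penalizedSup_le_iff]
      intro t ht
      have := mul_nonneg hN
        (centeredCgf_nonneg (mem_interior_fullParams hθ) (mem_fullParams ht))
      linarith
    · have h0 : (0 : ℝ) ∈ (θ + ·) ⁻¹' E.Θ := by simpa using interior_subset hθ
      simpa using le_penalizedSup (K := E.centeredCgf θ) (N := N) (w := 0) h0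
  rw [h1, mul_one]

/-- Dividing the normalizer by the likelihood maximum e^{n(θμ - A(θ))} leaves the factor e^{θz -
A(θ)} in the integrand, which changes the reference measure into the law of θ. -/
lemma lintegral_penalizedSup_eq {θ : ℝ} (hθ : θ ∈ interior E.Θ) (n : ℕ) :
    ∫⁻ x, penalizedSup ((θ + ·) ⁻¹' E.Θ) (E.centeredCgf θ) (n + 1 : ℕ) (x - E.mean θ) ∂E.dist θ =
      (penalizedSup E.Θ E.A n (n * E.mean θ) / E.normalizer n (n * E.mean θ))⁻¹ := by
  have hmeas : Measurable fun x => penalizedSup ((θ + ·) ⁻¹' E.Θ) (E.centeredCgf θ) (n + 1 : ℕ)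
      (x - E.mean θ) := (measurable_penalizedSup _ _ _).comp (measurable_sub_const _)
  rw [ENNReal.inv_div (Or.inr (by rw [penalizedSup_mean hθ n.cast_nonneg]; simp))
    (Or.inr (penalizedSup_pos E.Θ_nonempty _ _ _).ne'), penalizedSup_mean hθ n.cast_nonneg]
  rw [ENNReal.eq_div_iff (by simp [Real.exp_pos]) ENNReal.ofReal_ne_top, dist_eq_withDensity,
    lintegral_withDensity_eq_lintegral_mul _ (by fun_prop) hmeas, normalizer,
    ← lintegral_const_mul' _ _ ENNReal.ofReal_ne_top]
  refine lintegral_congr fun z => ?_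
  have h := penalizedSup_eq_mul (E := E) θ (n + 1 : ℕ) (z - E.mean θ)
  rw [show ((n + 1 : ℕ) : ℝ) * E.mean θ + (z - E.mean θ) = n * E.mean θ + z by
    push_cast; ring] at h
  rw [h, Pi.mul_apply, ← mul_assoc, ← ENNReal.ofReal_mul (Real.exp_pos _).le, ← Real.exp_add]
  congr 3
  push_cast; ring

variable (E) in
/-- The coefficient of `1 / N²` in the expansion of the ratio of normalizer and maximized
likelihood. -/
noncomputable def secondOrderCoeff (θ : ℝ) : ℝ :=
  (iteratedDeriv 4 E.A θ + 3 * iteratedDeriv 2 E.A θ ^ 2) / (8 * iteratedDeriv 2 E.A θ ^ 2) -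
    iteratedDeriv 3 E.A θ * iteratedDeriv 3 E.A θ / (6 * iteratedDeriv 2 E.A θ ^ 3)

/-- The expansion parameter is n + 1, not n, because the normalizer integrates the likelihood of n +
1 outcomes. Finiteness at the single length n₀ supplies the level against which the tail is
dominated. -/
lemma tendsto_ratio (hE : E.Nondegenerate) {θ : ℝ} (hθ : θ ∈ interior E.Θ) {n₀ : ℕ}
    (hfin : E.normalizer n₀ (n₀ * E.mean θ) ≠ ∞) :
    Filter.Tendsto (fun n : ℕ => ((n + 1 : ℕ) : ℝ) ^ 2 *
      ((penalizedSup E.Θ E.A n (n * E.mean θ) / E.normalizer n (n * E.mean θ))⁻¹.toReal - 1 -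
        1 / (2 * (n + 1 : ℕ)))) Filter.atTop (nhds (E.secondOrderCoeff θ)) := by
  have hθf := mem_interior_fullParams hθ
  have := isProbabilityMeasure_dist (interior_subset hθf)
  obtain ⟨C, hC, ρ₀, hρ₀, htay⟩ := exists_centeredCgf_taylor hθf
  obtain ⟨h2, h3, h4⟩ := integral_centered_pow hθf
  have hT : (θ + ·) ⁻¹' E.Θ ∈ nhds (0 : ℝ) := by
    have hc : ContinuousAt (fun t : ℝ => θ + t) 0 := by fun_prop
    exact hc.preimage_mem_nhds (by simpa using mem_interior_iff_mem_nhds.1 hθ)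
  obtain ⟨a, ha, hexp⟩ : ∃ a > 0,
      Integrable (fun x => Real.exp (a * |x - E.mean θ|)) (E.dist θ) := by
    obtain ⟨r, hr, hball⟩ := Metric.mem_nhds_iff.1
      (mem_interior_iff_mem_nhds.1 (zero_mem_interior_centered hθf))
    refine ⟨r / 2, by positivity, integrable_exp_mul_abs (X := fun x => x - E.mean θ)
      (hball ?_) (hball ?_)⟩ <;>
    · simp [abs_of_pos hr]; linarith
  have hlin := exists_centeredCgf_linear_lower_bound hE hθf
  have hfin' : ∫⁻ x, penalizedSup ((θ + ·) ⁻¹' E.Θ) (E.centeredCgf θ) ((n₀ + 1 : ℕ) : ℝ)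
      (x - E.mean θ) ∂E.dist θ ≠ ∞ := by
    rw [lintegral_penalizedSup_eq hθ]
    exact ENNReal.inv_ne_top.2 (ENNReal.div_ne_zero.2
      ⟨(penalizedSup_pos E.Θ_nonempty _ _ _).ne', hfin⟩)
  have key := tendsto_lintegral_penalizedSup (P := E.dist θ) (X := fun x => x - E.mean θ)
    (by fun_prop) hT (fun t ht => centeredCgf_nonneg hθf (mem_fullParams ht))
    (iteratedDeriv_two_A_pos hE hθf) hC hρ₀ htay
    (fun ρ hρ => (hlin ρ hρ).imp fun k hk => ⟨hk.1, fun t ht => hk.2 t (mem_fullParams ht)⟩)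
    ha hexp h2 (Nat.cast_nonneg _) hfin'
  rw [h3, h4] at key
  have := key.comp (tendsto_natCast_atTop_atTop.comp (Filter.tendsto_add_atTop_nat 1))
  refine this.congr fun n => ?_
  simp only [Function.comp_apply]
  rw [lintegral_penalizedSup_eq hθ]

/-! ### The mean-value parameterization -/

lemma integral_sub_const_dist {θ : ℝ} (hθ : θ ∈ E.fullParams)
    (hi : Integrable (fun x : ℝ => x) (E.dist θ)) (c : ℝ) :
    ∫ x, (x - c) ∂E.dist θ = E.mean θ - c := by
  have := isProbabilityMeasure_dist hθ
  rw [integral_sub hi (integrable_const _)]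
  simp [mean]

/-- The two tilted densities cross at c, the difference quotient of `A`. Their difference times x -
c is positive off c and integrates to the difference of the means. `A` is not differentiated, so end
points are allowed. -/
lemma mean_lt_mean (hE : E.Nondegenerate) {θ₁ θ₂ : ℝ} (h₁ : θ₁ ∈ E.fullParams)
    (h₂ : θ₂ ∈ E.fullParams) (hi₁ : Integrable (fun x : ℝ => x) (E.dist θ₁))
    (hi₂ : Integrable (fun x : ℝ => x) (E.dist θ₂)) (hlt : θ₁ < θ₂) :
    E.mean θ₁ < E.mean θ₂ := by
  have hd : 0 < θ₂ - θ₁ := sub_pos.2 hlt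
  set c := (E.A θ₂ - E.A θ₁) / (θ₂ - θ₁) with hc
  have hcd : (θ₂ - θ₁) * c = E.A θ₂ - E.A θ₁ := by rw [hc]; field_simp
  have hint : ∀ θ, θ ∈ E.fullParams → Integrable (fun x : ℝ => x) (E.dist θ) →
      Integrable (fun x => Real.exp (θ * x - E.A θ) * (x - c)) E.reference := by
    intro θ hθ hi
    have := isProbabilityMeasure_dist hθ
    have := ((integrable_dist_iff hθ _).1 (hi.sub (integrable_const c))).const_mul
      (Real.exp (-E.A θ))
    refine this.congr (ae_of_all _ fun x => ?_)
    simp only [Pi.sub_apply]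
    rw [← mul_assoc, ← Real.exp_add]; ring_nf
  have hdiff : E.mean θ₂ - E.mean θ₁ = ∫ x, (Real.exp (θ₂ * x - E.A θ₂) * (x - c) -
      Real.exp (θ₁ * x - E.A θ₁) * (x - c)) ∂E.reference := by
    rw [integral_sub (hint θ₂ h₂ hi₂) (hint θ₁ h₁ hi₁), ← integral_dist h₁, ← integral_dist h₂,
      integral_sub_const_dist h₁ hi₁, integral_sub_const_dist h₂ hi₂]
    ring
  have hexp : ∀ x, θ₂ * x - E.A θ₂ - (θ₁ * x - E.A θ₁) = (θ₂ - θ₁) * (x - c) := by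
    intro x; rw [mul_sub, hcd]; ring
  have hpos : ∀ x, x ≠ c → 0 < Real.exp (θ₂ * x - E.A θ₂) * (x - c) -
      Real.exp (θ₁ * x - E.A θ₁) * (x - c) := by
    intro x hx
    rw [← sub_mul]
    rcases lt_or_gt_of_ne hx with h | h
    · refine mul_pos_of_neg_of_neg (sub_neg.2 (Real.exp_lt_exp.2 ?_)) (sub_neg.2 h)
      nlinarith [hexp x]
    · refine mul_pos (sub_pos.2 (Real.exp_lt_exp.2 ?_)) (sub_pos.2 h)
      nlinarith [hexp x]
  have hnonneg : 0 ≤ fun x => Real.exp (θ₂ * x - E.A θ₂) * (x - c) -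
      Real.exp (θ₁ * x - E.A θ₁) * (x - c) := by
    intro x
    rcases eq_or_ne x c with rfl | hx
    · simp
    · exact (hpos x hx).le
  rw [← sub_pos, hdiff]
  refine (integral_nonneg hnonneg).lt_of_ne fun h => hE c ?_
  have h0 := (integral_eq_zero_iff_of_nonneg hnonneg
    ((hint θ₂ h₂ hi₂).sub (hint θ₁ h₁ hi₁))).1 h.symm
  filter_upwards [h0] with x hx
  by_contra hxc
  exact (hpos x hxc).ne' hx

lemma strictMonoOn_mean (hE : E.Nondegenerate) : StrictMonoOn E.mean E.finiteMeanParams :=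
  fun _ h₁ _ h₂ hlt =>
    mean_lt_mean hE (mem_fullParams h₁.1) (mem_fullParams h₂.1) h₁.2 h₂.2 hlt

lemma mem_finiteMeanParams {θ : ℝ} (hθ : θ ∈ interior E.Θ) : θ ∈ E.finiteMeanParams :=
  ⟨interior_subset hθ, integrable_id_dist (mem_interior_fullParams hθ)⟩

/-- A point mass yields a single mean, so nondegeneracy comes for free wherever the conclusion has
content. -/
lemma nondegenerate_of_mem_interior_meanSpace {μ : ℝ} (hμ : μ ∈ interior E.meanSpace) :
    E.Nondegenerate := by
  intro c hc
  have hsub : E.meanSpace ⊆ {c} := by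
    rintro _ ⟨θ, hθ, rfl⟩
    have := isProbabilityMeasure_dist (mem_fullParams hθ.1)
    have hac : E.dist θ ≪ E.reference := by
      rw [dist_eq_withDensity]; exact withDensity_absolutelyContinuous _ _
    rw [Set.mem_singleton_iff, mean, integral_congr_ae (hac hc)]
    simp
  have := interior_mono hsub hμ
  simp at this

/-- `Θ` need not be an interval, so gaps near θ must be excluded. Nearby means on both sides come
from θ₁ < θ < θ₂ in `Θ`. Any t between these has its mean near μ, hence shared with some t' in `Θ`;
strict monotonicity on the full parameter space forces t' = t. -/
lemma exists_mem_interior_of_mem_interior_meanSpace {μ : ℝ} (hμ : μ ∈ interior E.meanSpace) :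
    ∃ θ ∈ interior E.Θ, E.mean θ = μ := by
  have hE := nondegenerate_of_mem_interior_meanSpace hμ
  obtain ⟨ε, hε, hball⟩ := Metric.mem_nhds_iff.1 (mem_interior_iff_mem_nhds.1 hμ)
  have hmem : ∀ y, |y - μ| < ε → y ∈ E.meanSpace := fun y hy => hball hy
  obtain ⟨θ, hθ, hθμ⟩ := interior_subset hμ
  obtain ⟨θ₁, h₁, hθ₁⟩ := hmem (μ - ε / 2) (by rw [abs_lt]; constructor <;> linarith)
  obtain ⟨θ₂, h₂, hθ₂⟩ := hmem (μ + ε / 2) (by rw [abs_lt]; constructor <;> linarith)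
  have hlt₁ : θ₁ < θ := ((strictMonoOn_mean hE).lt_iff_lt h₁ hθ).1 (by linarith)
  have hlt₂ : θ < θ₂ := ((strictMonoOn_mean hE).lt_iff_lt hθ h₂).1 (by linarith)
  have hfull : Set.Icc θ₁ θ₂ ⊆ E.fullParams :=
    (convex_integrableExpSet (X := fun x : ℝ => x)).ordConnected.out
      (mem_fullParams h₁.1) (mem_fullParams h₂.1)
  have hsub : Set.Ioo θ₁ θ₂ ⊆ E.Θ := by
    intro t ht
    have htf : t ∈ interior E.fullParams :=
      interior_maximal (Set.Ioo_subset_Icc_self.trans hfull) isOpen_Ioo ht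
    have hti := integrable_id_dist htf
    have hm₁ := mean_lt_mean hE (mem_fullParams h₁.1) (interior_subset htf) h₁.2 hti ht.1
    have hm₂ := mean_lt_mean hE (interior_subset htf) (mem_fullParams h₂.1) hti h₂.2 ht.2
    obtain ⟨t', ht', htt'⟩ := hmem (E.mean t) (by rw [abs_lt]; constructor <;> linarith)
    rcases lt_trichotomy t t' with h | h | h
    · exact absurd htt' (mean_lt_mean hE (interior_subset htf) (mem_fullParams ht'.1) hti
        ht'.2 h).ne'
    · exact h ▸ ht'.1
    · exact absurd htt' (mean_lt_mean hE (mem_fullParams ht'.1) (interior_subset htf) ht'.2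
        hti h).ne
  exact ⟨θ, interior_maximal hsub isOpen_Ioo ⟨hlt₁, hlt₂⟩, hθμ⟩

/-! ### The second order coefficient is constant -/

/-- Otherwise x - μ would be almost surely nonnegative with mean zero, hence zero almost surely. -/
lemma frequently_lt_mean (hE : E.Nondegenerate) {θ : ℝ} (hθ : θ ∈ interior E.fullParams) :
    ∃ᶠ x in ae E.reference, x < E.mean θ := by
  intro h
  refine hE (E.mean θ) ?_
  have hθ' := interior_subset hθ
  have := isProbabilityMeasure_dist hθ'
  have hac : E.dist θ ≪ E.reference := by
    rw [dist_eq_withDensity]; exact withDensity_absolutelyContinuous _ _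
  have hi := integrable_id_dist hθ
  have h0 := (integral_eq_zero_iff_of_nonneg_ae (f := fun x => x - E.mean θ) (μ := E.dist θ)
    (by filter_upwards [hac h] with x hx using sub_nonneg.2 (not_lt.1 hx))
    (hi.sub (integrable_const _))).1 (by rw [integral_sub_const_dist hθ' hi]; simp)
  filter_upwards [reference_absolutelyContinuous_dist hθ' h0] with x hx using sub_eq_zero.1 hx

lemma frequently_mean_lt (hE : E.Nondegenerate) {θ : ℝ} (hθ : θ ∈ interior E.fullParams) :
    ∃ᶠ x in ae E.reference, E.mean θ < x := by
  intro h
  refine hE (E.mean θ) ?_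
  have hθ' := interior_subset hθ
  have := isProbabilityMeasure_dist hθ'
  have hac : E.dist θ ≪ E.reference := by
    rw [dist_eq_withDensity]; exact withDensity_absolutelyContinuous _ _
  have hi := integrable_id_dist hθ
  have h0 := (integral_eq_zero_iff_of_nonneg_ae (f := fun x => -(x - E.mean θ)) (μ := E.dist θ)
    (by filter_upwards [hac h] with x hx using neg_nonneg.2 (sub_nonpos.2 (not_lt.1 hx)))
    (hi.sub (integrable_const _)).neg).1
    (by rw [integral_neg, integral_sub_const_dist hθ' hi]; simp)
  filter_upwards [reference_absolutelyContinuous_dist hθ' h0] with x hx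
  exact sub_eq_zero.1 (neg_eq_zero.1 hx)

/-- Two parameters whose means divide `[a, b]` in rational proportions with a common denominator
have the same second order coefficient. -/
lemma secondOrderCoeff_eq_of_rational (hE : E.Nondegenerate) {m : ℕ}
    (hex : E.SNMLExchangeable m) {a b : ℝ} (ha : a ∈ E.sampleSpace) (hb : b ∈ E.sampleSpace)
    (hLa : penalizedSup E.Θ E.A 1 a ≠ ∞) (hLb : penalizedSup E.Θ E.A 1 b ≠ ∞)
    (hZ : E.normalizer m (m * a) ≠ ∞) {θ₁ θ₂ : ℝ} (hθ₁ : θ₁ ∈ interior E.Θ)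
    (hθ₂ : θ₂ ∈ interior E.Θ) {p₁ p₂ q : ℕ} (hp₁ : p₁ < q) (hp₂ : p₂ < q)
    (h₁ : E.mean θ₁ = a + p₁ / q * (b - a)) (h₂ : E.mean θ₂ = a + p₂ / q * (b - a)) :
    E.secondOrderCoeff θ₁ = E.secondOrderCoeff θ₂ := by
  have hq : 0 < q := by omega
  have hsum : ∀ {θ : ℝ} {p K : ℕ}, E.mean θ = a + p / q * (b - a) →
      ((K * q : ℕ) : ℝ) * E.mean θ = (K * q : ℕ) * a + (K * p : ℕ) * (b - a) := by
    intro θ p K h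
    rw [h]; push_cast; field_simp
  -- Since q - p ≥ 1, taking K ≥ m + 1 leaves more than m copies of a besides the Kp copies of b.
  have hle : ∀ {p K : ℕ}, p < q → m + 1 ≤ K → m + K * p + 1 ≤ K * q := by
    intro p K hp hK
    calc m + K * p + 1 ≤ K * p + K := by omega
      _ = K * (p + 1) := by ring
      _ ≤ K * q := Nat.mul_le_mul_left _ hp
  have hratio : ∀ {θ : ℝ} {p K : ℕ}, E.mean θ = a + p / q * (b - a) → p < q → m + 1 ≤ K →
      penalizedSup E.Θ E.A (K * q : ℕ) ((K * q : ℕ) * E.mean θ) /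
        E.normalizer (K * q) ((K * q : ℕ) * E.mean θ) =
      penalizedSup E.Θ E.A (K * q : ℕ) ((K * q : ℕ) * a) /
        E.normalizer (K * q) ((K * q : ℕ) * a) := by
    intro θ p K h hp hK
    rw [hsum h]
    have := hle hp hK
    obtain ⟨k, hk⟩ := Nat.exists_eq_add_of_le (show m + 1 ≤ K * q by omega)
    rw [show K * q = m + k + 1 by omega]
    exact div_normalizer_eq hex ha hb hLa hLb hZ k (K * p) (by omega)
  have hfin : ∀ {θ : ℝ} {p : ℕ}, E.mean θ = a + p / q * (b - a) → p < q →
      E.normalizer ((m + 1) * q) (((m + 1) * q : ℕ) * E.mean θ) ≠ ∞ := by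
    intro θ p h hp
    rw [hsum h]
    have := hle hp le_rfl
    obtain ⟨k, hk⟩ := Nat.exists_eq_add_of_le (show m ≤ (m + 1) * q by omega)
    rw [hk]
    exact normalizer_ne_top_of_counts hLa hLb hZ k _ (by omega)
  have hK : Filter.Tendsto (fun K : ℕ => K * q) Filter.atTop Filter.atTop :=
    Filter.tendsto_id.atTop_mul_const' hq
  -- Along the multiples of q the two ratios coincide, both being equal to the ratio for data
  -- consisting only of a, so their expansions have the same limit.
  refine tendsto_nhds_unique ((tendsto_ratio hE hθ₁ (hfin h₁ hp₁)).comp hK)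
    (((tendsto_ratio hE hθ₂ (hfin h₂ hp₂)).comp hK).congr' ?_)
  filter_upwards [Filter.eventually_ge_atTop (m + 1)] with K hKm
  simp only [Function.comp_apply]
  rw [hratio h₁ hp₁ hKm, hratio h₂ hp₂ hKm]

lemma hasDerivAt_mean {θ : ℝ} (hθ : θ ∈ interior E.fullParams) :
    HasDerivAt E.mean (iteratedDeriv 2 E.A θ) θ := by
  have h := hasDerivAt_iteratedDeriv_A hθ 1
  rw [iteratedDeriv_one] at h
  refine h.congr_of_eventuallyEq ?_
  filter_upwards [isOpen_interior.mem_nhds hθ] with t ht using mean_eq_deriv ht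

/-- The mean is continuous and strictly increasing, so the means from a short interval to the right
of θ fill an interval, which contains a rational division point of [a, b]. -/
lemma exists_rational_mean (hE : E.Nondegenerate) {θ a b : ℝ} (hθ : θ ∈ interior E.Θ)
    (ha : a < E.mean θ) (hb : E.mean θ < b) {U : Set ℝ} (hU : U ∈ nhds θ) :
    ∃ θ' ∈ U, θ' ∈ interior E.Θ ∧ ∃ r : ℚ, 0 < r ∧ r < 1 ∧ E.mean θ' = a + r * (b - a) := by
  have hab : 0 < b - a := by linarith
  have hc : ContinuousAt E.mean θ := (hasDerivAt_mean (mem_interior_fullParams hθ)).continuousAt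
  have hW : U ∩ interior E.Θ ∩ E.mean ⁻¹' Set.Ioo a b ∈ nhds θ :=
    Filter.inter_mem (Filter.inter_mem hU (isOpen_interior.mem_nhds hθ))
      (hc.preimage_mem_nhds (Ioo_mem_nhds ha hb))
  obtain ⟨ε, hε, hball⟩ := Metric.mem_nhds_iff.1 hW
  have hIcc : Set.Icc θ (θ + ε / 2) ⊆ U ∩ interior E.Θ ∩ E.mean ⁻¹' Set.Ioo a b := by
    refine Set.Subset.trans (fun t ht => ?_) hball
    rw [Metric.mem_ball, Real.dist_eq, abs_lt]
    constructor <;> linarith [ht.1, ht.2]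
  have hle : θ ≤ θ + ε / 2 := by linarith
  have hend := hIcc (Set.right_mem_Icc.2 hle)
  have hlt : E.mean θ < E.mean (θ + ε / 2) :=
    strictMonoOn_mean hE (mem_finiteMeanParams hθ) (mem_finiteMeanParams hend.1.2) (by linarith)
  obtain ⟨r, hr₁, hr₂⟩ := exists_rat_btwn (div_lt_div_of_pos_right (sub_lt_sub_right hlt a) hab)
  rw [div_lt_iff₀ hab] at hr₁
  rw [lt_div_iff₀ hab] at hr₂
  have hcont : ContinuousOn E.mean (Set.Icc θ (θ + ε / 2)) := fun t ht =>
    (hasDerivAt_mean (mem_interior_fullParams (hIcc ht).1.2)).continuousAt.continuousWithinAt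
  obtain ⟨t, ht, htr⟩ := intermediate_value_Icc hle hcont
    (show a + r * (b - a) ∈ _ from ⟨by linarith, by linarith⟩)
  have htI := (hIcc ht).2
  rw [Set.mem_preimage, htr] at htI
  refine ⟨t, (hIcc ht).1.1, (hIcc ht).1.2, r, ?_, ?_, htr⟩
  · have : 0 < (r : ℝ) := pos_of_mul_pos_left (by linarith [htI.1]) hab.le
    exact_mod_cast this
  · have : (r : ℝ) < 1 := lt_of_mul_lt_mul_right (by linarith [htI.2]) hab.le
    exact_mod_cast this

lemma continuousAt_secondOrderCoeff (hE : E.Nondegenerate) {θ : ℝ}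
    (hθ : θ ∈ interior E.fullParams) : ContinuousAt E.secondOrderCoeff θ := by
  have hc := fun k => (analyticAt_iteratedDeriv_A hθ k).continuousAt
  have hV := (iteratedDeriv_two_A_pos hE hθ).ne'
  have h2 := hc 2
  have h3 := hc 3
  have h4 := hc 4
  unfold secondOrderCoeff
  exact ((h4.add (continuousAt_const.mul (h2.pow 2))).div (continuousAt_const.mul (h2.pow 2))
    (mul_ne_zero (by norm_num) (pow_ne_zero _ hV))).sub
      ((h3.mul h3).div (continuousAt_const.mul (h2.pow 3))
        (mul_ne_zero (by norm_num) (pow_ne_zero _ hV)))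

/-- One pair a, b enclosing both means serves both parameters, since outcomes on either side of a
mean have positive reference measure. The rational case then extends by density and continuity. -/
theorem secondOrderCoeff_eq (hE : E.Nondegenerate) {m : ℕ} (hm : E.IsInitialLength m)
    (hex : E.SNMLExchangeable m) {θ₁ θ₂ : ℝ} (hθ₁ : θ₁ ∈ interior E.Θ)
    (hθ₂ : θ₂ ∈ interior E.Θ) : E.secondOrderCoeff θ₁ = E.secondOrderCoeff θ₂ := by
  have hae := ae_reference_mem_sampleSpace (E := E) |>.and hm.ae_penalizedSup_ne_top
  have hmf₁ := mem_interior_fullParams hθ₁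
  have hmf₂ := mem_interior_fullParams hθ₂
  obtain ⟨a, ⟨ha, hLa⟩, ha₁, ha₂⟩ : ∃ a, (a ∈ E.sampleSpace ∧ penalizedSup E.Θ E.A 1 a ≠ ∞) ∧
      a < E.mean θ₁ ∧ a < E.mean θ₂ := by
    rcases le_total (E.mean θ₁) (E.mean θ₂) with h | h
    · obtain ⟨a, hlt, h'⟩ := ((frequently_lt_mean hE hmf₁).and_eventually hae).exists
      exact ⟨a, h', hlt, hlt.trans_le h⟩
    · obtain ⟨a, hlt, h'⟩ := ((frequently_lt_mean hE hmf₂).and_eventually hae).exists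
      exact ⟨a, h', hlt.trans_le h, hlt⟩
  obtain ⟨b, ⟨hb, hLb⟩, hb₁, hb₂⟩ : ∃ b, (b ∈ E.sampleSpace ∧ penalizedSup E.Θ E.A 1 b ≠ ∞) ∧
      E.mean θ₁ < b ∧ E.mean θ₂ < b := by
    rcases le_total (E.mean θ₁) (E.mean θ₂) with h | h
    · obtain ⟨b, hlt, h'⟩ := ((frequently_mean_lt hE hmf₂).and_eventually hae).exists
      exact ⟨b, h', h.trans_lt hlt, hlt⟩
    · obtain ⟨b, hlt, h'⟩ := ((frequently_mean_lt hE hmf₁).and_eventually hae).exists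
      exact ⟨b, h', hlt, h.trans_lt hlt⟩
  -- Distinct values would have disjoint neighbourhoods; moving each parameter slightly to one with
  -- rational proportion keeps the values in them, and a common denominator makes these values
  -- equal.
  by_contra hne
  obtain ⟨U, W, hU, hW, h1U, h2W, hdisj⟩ := t2_separation hne
  obtain ⟨t₁, ht₁U, ht₁, r₁, hr₁0, hr₁1, hr₁⟩ := exists_rational_mean hE hθ₁ ha₁ hb₁
    ((continuousAt_secondOrderCoeff hE hmf₁).preimage_mem_nhds (hU.mem_nhds h1U))
  obtain ⟨t₂, ht₂W, ht₂, r₂, hr₂0, hr₂1, hr₂⟩ := exists_rational_mean hE hθ₂ ha₂ hb₂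
    ((continuousAt_secondOrderCoeff hE hmf₂).preimage_mem_nhds (hW.mem_nhds h2W))
  have hnum : ∀ r : ℚ, 0 < r → r < 1 → ∃ p : ℕ, p < r.den ∧ (r : ℝ) = p / r.den := by
    intro r h0 h1
    refine ⟨r.num.toNat, ?_, ?_⟩
    · have hlt : r.num < r.den := by
        have := (Rat.lt_iff r 1).1 h1
        simpa using this
      have := r.den_pos
      omega
    · have h : ((r.num.toNat : ℤ) : ℝ) = (r.num : ℝ) := by
        rw [Int.toNat_of_nonneg (Rat.num_nonneg.2 h0.le)]
      rw [Int.cast_natCast] at h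
      rw [h]
      exact Rat.cast_def r
  obtain ⟨p₁, hp₁, e₁⟩ := hnum r₁ hr₁0 hr₁1
  obtain ⟨p₂, hp₂, e₂⟩ := hnum r₂ hr₂0 hr₂1
  have hd₁ : (r₁.den : ℝ) ≠ 0 := by exact_mod_cast r₁.den_ne_zero
  have hd₂ : (r₂.den : ℝ) ≠ 0 := by exact_mod_cast r₂.den_ne_zero
  have heq := secondOrderCoeff_eq_of_rational hE hex ha hb hLa hLb (hm.normalizer_ne_top ha)
    ht₁ ht₂ (p₁ := p₁ * r₂.den) (p₂ := r₁.den * p₂) (q := r₁.den * r₂.den)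
    (Nat.mul_lt_mul_of_pos_right hp₁ r₂.den_pos) (Nat.mul_lt_mul_of_pos_left hp₂ r₁.den_pos)
    (by rw [hr₁, e₁]; push_cast; field_simp) (by rw [hr₂, e₂]; push_cast; field_simp)
  exact Set.disjoint_left.1 hdisj ht₁U (heq ▸ ht₂W)

/-! ### The standard deviation as a function of the mean -/

variable (E) in
/-- The natural parameter as a function of the mean. -/
noncomputable def param (μ : ℝ) : ℝ := Function.invFunOn E.mean E.finiteMeanParams μ

lemma param_mean (hE : E.Nondegenerate) {θ : ℝ} (hθ : θ ∈ interior E.Θ) :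
    E.param (E.mean θ) = θ :=
  (strictMonoOn_mean hE).injOn.leftInvOn_invFunOn (mem_finiteMeanParams hθ)

lemma param_mem_interior {μ : ℝ} (hμ : μ ∈ interior E.meanSpace) :
    E.param μ ∈ interior E.Θ := by
  obtain ⟨θ, hθ, rfl⟩ := exists_mem_interior_of_mem_interior_meanSpace hμ
  rwa [param_mean (nondegenerate_of_mem_interior_meanSpace hμ) hθ]

lemma mean_param {μ : ℝ} (hμ : μ ∈ interior E.meanSpace) : E.mean (E.param μ) = μ := by
  obtain ⟨θ, hθ, rfl⟩ := exists_mem_interior_of_mem_interior_meanSpace hμ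
  rw [param_mean (nondegenerate_of_mem_interior_meanSpace hμ) hθ]

lemma σ_eq {μ : ℝ} (hμ : μ ∈ interior E.meanSpace) :
    E.σ μ = Real.sqrt (iteratedDeriv 2 E.A (E.param μ)) := by
  rw [σ, V, ← variance_eq_iteratedDeriv (mem_interior_fullParams (param_mem_interior hμ)), param]

lemma hasStrictDerivAt_deriv_A {θ : ℝ} (hθ : θ ∈ interior E.fullParams) :
    HasStrictDerivAt (deriv E.A) (iteratedDeriv 2 E.A θ) θ := by
  have h := (analyticAt_A hθ).deriv.hasStrictDerivAt
  rwa [iteratedDeriv_succ, iteratedDeriv_one]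

lemma eventually_param_deriv_A (hE : E.Nondegenerate) {θ : ℝ} (hθ : θ ∈ interior E.Θ) :
    ∀ᶠ t in nhds θ, E.param (deriv E.A t) = t := by
  filter_upwards [isOpen_interior.mem_nhds hθ] with t ht
  rw [← mean_eq_deriv (mem_interior_fullParams ht), param_mean hE ht]

lemma hasDerivAt_param {μ : ℝ} (hμ : μ ∈ interior E.meanSpace) :
    HasDerivAt E.param (iteratedDeriv 2 E.A (E.param μ))⁻¹ μ := by
  have hE := nondegenerate_of_mem_interior_meanSpace hμ
  have hθ := param_mem_interior hμ
  have hθf := mem_interior_fullParams hθ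
  have h := (hasStrictDerivAt_deriv_A hθf).to_local_left_inverse
    (iteratedDeriv_two_A_pos hE hθf).ne' (eventually_param_deriv_A hE hθ)
  rw [← mean_eq_deriv hθf, mean_param hμ] at h
  exact h.hasDerivAt

/-- The inverse chosen by `Function.invFunOn` agrees near μ with the smooth local inverse of A',
because it is a left inverse of A' near the parameter. -/
lemma contDiffAt_param {μ : ℝ} (hμ : μ ∈ interior E.meanSpace) :
    ContDiffAt ℝ 2 E.param μ := by
  have hE := nondegenerate_of_mem_interior_meanSpace hμ
  have hθ := param_mem_interior hμ
  have hθf := mem_interior_fullParams hθ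
  have hV := (iteratedDeriv_two_A_pos hE hθf).ne'
  have hcd : ContDiffAt ℝ 2 (deriv E.A) (E.param μ) := (analyticAt_A hθf).deriv.contDiffAt
  have hd := (hasStrictDerivAt_deriv_A hθf).hasStrictFDerivAt_equiv hV
  have h := hcd.to_localInverse hd.hasFDerivAt two_ne_zero
  have heq := (hcd.hasStrictFDerivAt' hd.hasFDerivAt two_ne_zero).localInverse_unique
    (eventually_param_deriv_A hE hθ)
  rw [← mean_eq_deriv hθf, mean_param hμ] at h heq
  exact h.congr_of_eventuallyEq heq

lemma contDiffAt_σ {μ : ℝ} (hμ : μ ∈ interior E.meanSpace) : ContDiffAt ℝ 2 E.σ μ := by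
  have hE := nondegenerate_of_mem_interior_meanSpace hμ
  have hθf := mem_interior_fullParams (param_mem_interior hμ)
  have h : ContDiffAt ℝ 2 (fun y => Real.sqrt (iteratedDeriv 2 E.A (E.param y))) μ :=
    (ContDiffAt.comp μ (analyticAt_iteratedDeriv_A hθf 2).contDiffAt (contDiffAt_param hμ)).sqrt
      (iteratedDeriv_two_A_pos hE hθf).ne'
  refine h.congr_of_eventuallyEq ?_
  filter_upwards [isOpen_interior.mem_nhds hμ] with y hy using σ_eq hy

lemma hasDerivAt_iteratedDeriv_param (k : ℕ) {μ : ℝ} (hμ : μ ∈ interior E.meanSpace) :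
    HasDerivAt (fun y => iteratedDeriv k E.A (E.param y))
      (iteratedDeriv (k + 1) E.A (E.param μ) * (iteratedDeriv 2 E.A (E.param μ))⁻¹) μ :=
  (hasDerivAt_iteratedDeriv_A (mem_interior_fullParams (param_mem_interior hμ)) k).comp μ
    (hasDerivAt_param hμ)

/-- Differentiate √(A''(θ(μ))) using dθ/dμ = 1/V. -/
lemma hasDerivAt_σ {μ : ℝ} (hμ : μ ∈ interior E.meanSpace) :
    HasDerivAt E.σ (iteratedDeriv 3 E.A (E.param μ) / (2 * E.σ μ ^ 3)) μ := by
  have hE := nondegenerate_of_mem_interior_meanSpace hμ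
  have hV := iteratedDeriv_two_A_pos hE (mem_interior_fullParams (param_mem_interior hμ))
  have h := (hasDerivAt_iteratedDeriv_param 2 hμ).sqrt hV.ne'
  have heq : E.σ =ᶠ[nhds μ] fun y => Real.sqrt (iteratedDeriv 2 E.A (E.param y)) := by
    filter_upwards [isOpen_interior.mem_nhds hμ] with y hy using σ_eq hy
  refine (h.congr_of_eventuallyEq heq).congr_deriv ?_
  rw [σ_eq hμ]
  have hs := Real.sqrt_pos.2 hV
  nth_rewrite 1 [← Real.sq_sqrt hV.le]
  field_simp

/-- The differential expression in the standard deviation is an affine function of the second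
order coefficient. -/
theorem deriv_σ_sq_add {μ : ℝ} (hμ : μ ∈ interior E.meanSpace) :
    deriv E.σ μ ^ 2 + 3 * E.σ μ * deriv (deriv E.σ) μ =
      12 * E.secondOrderCoeff (E.param μ) - 9 / 2 := by
  have hE := nondegenerate_of_mem_interior_meanSpace hμ
  have hV := iteratedDeriv_two_A_pos hE (mem_interior_fullParams (param_mem_interior hμ))
  have hσ : 0 < E.σ μ := by rw [σ_eq hμ]; exact Real.sqrt_pos.2 hV
  have hσ2 : iteratedDeriv 2 E.A (E.param μ) = E.σ μ ^ 2 := by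
    rw [σ_eq hμ, Real.sq_sqrt hV.le]
  have heq : deriv E.σ =ᶠ[nhds μ]
      fun y => iteratedDeriv 3 E.A (E.param y) / (2 * E.σ y ^ 3) := by
    filter_upwards [isOpen_interior.mem_nhds hμ] with y hy using (hasDerivAt_σ hy).deriv
  have h2 := (hasDerivAt_iteratedDeriv_param 3 hμ).fun_div
    (((hasDerivAt_σ hμ).fun_pow 3).const_mul 2) (by positivity)
  rw [heq.deriv_eq, h2.deriv, (hasDerivAt_σ hμ).deriv, secondOrderCoeff, hσ2]
  field_simp
  push_cast
  ring

end NatExpFamily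

theorem theorem1 (E : NatExpFamily) (m : ℕ) (hm : E.IsInitialLength m)
    (hex : E.SNMLExchangeable m) :
    ContDiffOn ℝ 2 E.σ (interior E.meanSpace) ∧
      ∃ c : ℝ, ∀ μ ∈ interior E.meanSpace,
        deriv E.σ μ ^ 2 + 3 * E.σ μ * deriv (deriv E.σ) μ = c := by
  refine ⟨fun μ hμ => (NatExpFamily.contDiffAt_σ hμ).contDiffWithinAt, ?_⟩
  rcases (interior E.meanSpace).eq_empty_or_nonempty with h | ⟨μ₀, hμ₀⟩
  · exact ⟨0, fun μ hμ => by simp [h] at hμ⟩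
  · refine ⟨12 * E.secondOrderCoeff (E.param μ₀) - 9 / 2, fun μ hμ => ?_⟩
    rw [NatExpFamily.deriv_σ_sq_add hμ, NatExpFamily.secondOrderCoeff_eq
      (NatExpFamily.nondegenerate_of_mem_interior_meanSpace hμ) hm hex
      (NatExpFamily.param_mem_interior hμ) (NatExpFamily.param_mem_interior hμ₀)]
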